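/- Notation: $\|\cdot\|_2$ is the spectral norm of a matrix, $\sigma_{\min}(A)$ the smallest singular value of a complex matrix $A$, and $A(u,z)=I_p-\sum_{j=1}^{d}\Phi_j(u)z^j$ for $u\in\mathbb R$, $z\in\mathbb C$. Let $d\in\mathbb N_0$ and $K,\delta,\gamma,\sigma_1,\sigma_2\in\mathbb R$ with $\delta,\gamma,\sigma_1>0$. Then there are $N_0\in\mathbb N_0$, $0<\rho<1$ and a constant $\mathcal K$, depending only on $d,K,\delta,\gamma,\sigma_1,\sigma_2$ (in particular not on the dimension $p$), such that the following holds. Let $p\in\mathbb N_0$ and let $\Phi_1,\dots,\Phi_d,\Sigma:\mathbb R\to\mathbb R^{p\times p}$ satisfy 1. $\sigma_{\min}(A(u,z))\ge\gamma$ for all $u\in\mathbb R$ and all $z\in\mathbb C$ with $|z|\le 1+\delta$; 2. $\|\Phi_j(u)-\Phi_j(v)\|_2\le K|u-v|$ for $1\le j\le d$ and $\|\Sigma(u)-\Sigma(v)\|_2\le K|u-v|$, for all $u,v\in\mathbb R$; 3. for every $u\in\mathbb R$, $\Sigma(u)$ is symmetric positive definite with all eigenvalues in $[\sigma_1,\sigma_2]$.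 Put $$f(\omega;u)=A(u,e^{-i\omega})^{-1}\,\Sigma(u)\,\bigl(A(u,e^{i\omega})^{-1}\bigr)^{\top},\qquad C_r(u)=\frac1{2\pi}\int_0^{2\pi}f(\omega;u)\,e^{ir\omega}\,d\omega\quad(r\in\mathbb Z).$$ Then for all $r\in\mathbb Z$ and $u,v\in\mathbb R$, $$\|C_r(u)-C_r(v)\|_2\le\mathcal K\,|u-v|\,\rho^{|r|}.$$ Moreover, let $N>N_0$ and let $\{X_{t,N}\}_{t\in\mathbb Z}$ be a square integrable $p$-dimensional process with $\sup_t\|\mathrm{var}[X_{t,N}]\|_2<\infty$ that satisfies, almost surely for each $t\in\mathbb Z$, $$X_{t,N}=\sum_{j=1}^{d}\Phi_j(t/N)X_{t-j,N}+\Sigma(t/N)^{1/2}\varepsilon_t,$$ where $\{\varepsilon_t\}_{t\in\mathbb Z}$ are square integrable, mutually uncorrelated random vectors with variance matrix $I_p$. Then $C^{(N)}_{t,\tau}=\mathrm{cov}[X_{t,N},X_{\tau,N}]$ satisfies, for all $t,\tau\in\mathbb Z$, $$\|C^{(N)}_{t,\tau}\|_2\le\mathcal K\rho^{|t-\tau|}\qquad\text{and}\qquad\|C^{(N)}_{t,\tau}-C_{t-\tau}(t/N)\|_2\le\frac{\mathcal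 K\,\rho^{|t-\tau|}}{N}.$$ -/

import Mathlib

open MeasureTheory ProbabilityTheory
open scoped Matrix MatrixOrder Matrix.Norms.L2Operator

/-- The autoregressive polynomial `A(u, z) = I_p - ∑_{j=1}^d Φ_j(u) z^j`, a complex matrix. -/
noncomputable def arPoly {p : ℕ} (d : ℕ) (Φ : ℕ → ℝ → Matrix (Fin p) (Fin p) ℝ) (u : ℝ) (z : ℂ) :
    Matrix (Fin p) (Fin p) ℂ :=
  1 - ∑ j ∈ Finset.Icc 1 d, z ^ j • (Φ j u).map Complex.ofReal

/-- The smallest singular value of `A` is at least `γ`, that is, `γ ‖x‖₂ ≤ ‖A x‖₂` for all `x`. -/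
def MinSingularValueGE {p : ℕ} (A : Matrix (Fin p) (Fin p) ℂ) (γ : ℝ) : Prop :=
  ∀ x : EuclideanSpace ℂ (Fin p), γ * ‖x‖ ≤ ‖Matrix.toEuclideanCLM (n := Fin p) (𝕜 := ℂ) A x‖

/-- The conditions on the coefficient functions `Φ_1, …, Φ_d` and `Σ` of a time-varying VAR(d)
model. Matrix norms are spectral (`ℓ²` operator) norms. -/
structure TVVARCoefficients {p : ℕ} (d : ℕ) (K δ γ σ₁ σ₂ : ℝ)
    (Φ : ℕ → ℝ → Matrix (Fin p) (Fin p) ℝ) (Sig : ℝ → Matrix (Fin p) (Fin p) ℝ) : Prop where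
  root : ∀ (u : ℝ) (z : ℂ), ‖z‖ ≤ 1 + δ → MinSingularValueGE (arPoly d Φ u z) γ
  lipschitz_coeff : ∀ j ∈ Finset.Icc 1 d, ∀ u v : ℝ, ‖Φ j u - Φ j v‖ ≤ K * |u - v|
  lipschitz_var : ∀ u v : ℝ, ‖Sig u - Sig v‖ ≤ K * |u - v|
  posDef : ∀ u : ℝ, (Sig u).PosDef
  eigenvalues_mem : ∀ u : ℝ, spectrum ℝ (Sig u) ⊆ Set.Icc σ₁ σ₂

/-- The covariance matrix `cov[X, Y]` of two random vectors. -/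
noncomputable def covMatrix {p : ℕ} {Ω : Type*} [MeasurableSpace Ω] (P : Measure Ω)
    (X Y : Ω → Fin p → ℝ) : Matrix (Fin p) (Fin p) ℝ :=
  Matrix.of fun a b => cov[fun ω => X ω a, fun ω => Y ω b; P]

/-- `X` is a square integrable process on `ℤ` with bounded covariance, and solves the time-varying
VAR(d) equation `X_t = ∑_{j=1}^d Φ_j(t/N) X_{t-j} + Σ(t/N)^{1/2} ε_t`, where the innovations `ε_t`
are uncorrelated random vectors with variance `I_p`. Without the boundedness, adding an explosive
solution of the homogeneous equation would give further solutions. -/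
structure IsTVVAR {p : ℕ} (d : ℕ) (Φ : ℕ → ℝ → Matrix (Fin p) (Fin p) ℝ)
    (Sig : ℝ → Matrix (Fin p) (Fin p) ℝ) (N : ℕ) {Ω : Type*} [MeasurableSpace Ω] (P : Measure Ω)
    (ε X : ℤ → Ω → Fin p → ℝ) : Prop where
  memLp_innov : ∀ t a, MemLp (fun ω => ε t ω a) 2 P
  var_innov : ∀ t, covMatrix P (ε t) (ε t) = 1
  uncorrelated_innov : ∀ s t, s ≠ t → covMatrix P (ε s) (ε t) = 0
  memLp : ∀ t a, MemLp (fun ω => X t ω a) 2 P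
  bounded : ∃ B : ℝ, ∀ t, ‖covMatrix P (X t) (X t)‖ ≤ B
  equation : ∀ t : ℤ, ∀ᵐ ω ∂P, X t ω =
    ∑ j ∈ Finset.Icc 1 d, Φ j ((t : ℝ) / N) *ᵥ X (t - j) ω
      + CFC.sqrt (Sig ((t : ℝ) / N)) *ᵥ ε t ω

/-- The local spectral density `f(ω; u) = A(u, e^{-iω})⁻¹ Σ(u) (A(u, e^{iω})⁻¹)ᵀ`. -/
noncomputable def localSpectralDensity {p : ℕ} (d : ℕ) (Φ : ℕ → ℝ → Matrix (Fin p) (Fin p) ℝ)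
    (Sig : ℝ → Matrix (Fin p) (Fin p) ℝ) (u ω : ℝ) : Matrix (Fin p) (Fin p) ℂ :=
  (arPoly d Φ u (Complex.exp (-Complex.I * ω)))⁻¹ * (Sig u).map Complex.ofReal *
    ((arPoly d Φ u (Complex.exp (Complex.I * ω)))⁻¹)ᵀ

/-- The local autocovariance `C_r(u) = (2π)⁻¹ ∫_0^{2π} f(ω; u) e^{irω} dω` (entrywise integral):
the covariance of `X_{t+r}(u)` and `X_t(u)` for the stationary VAR(d) process `X(u)` with
coefficients `Φ_j(u)`, `Σ(u)`. -/
noncomputable def localAutocov {p : ℕ} (d : ℕ) (Φ : ℕ → ℝ → Matrix (Fin p) (Fin p) ℝ)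
    (Sig : ℝ → Matrix (Fin p) (Fin p) ℝ) (r : ℤ) (u : ℝ) : Matrix (Fin p) (Fin p) ℂ :=
  Matrix.of fun a b => (2 * Real.pi : ℂ)⁻¹ *
    ∫ ω in (0 : ℝ)..(2 * Real.pi),
      localSpectralDensity d Φ Sig u ω a b * Complex.exp (Complex.I * r * ω)

/-! Everything rests on one dimension-free stability principle. Suppose a bounded sequence satisfies
`Z t = ∑ Ψ j t * Z (t - j) + W t`, where the coefficients move by at most `κ` per step. Freeze them
at time `t` and invert the frozen operator by its Green sequence, which is bounded by `γ⁻¹ (1 +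
δ)⁻ᵏ` by Cauchy's estimate on the circle of radius `1 + δ`. Freezing costs an error of order `κ k`
at lag `k`, and the geometric decay sums this. A bound `‖Z‖ ≤ M φ`, with `φ` dominating `‖W‖`, thus
improves to `(c₁ + κ c₂ M) φ`. For small `κ` this is a contraction, and `‖Z‖ ≤ 2 c₁ φ` follows for
every weight `φ` that decays no faster than `ρ` (`stability_step`, `exists_stability`).

All the estimates are instances of this principle. Along a constant path it bounds the Green
coefficients, the local autocovariances, and their increments in `u`, since an increment solves the
same recursion with a residual of order `|u - v|` (`IsStableRate.geomLipschitz`). Along the path `t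
/ N`, where `κ = 1 / N`, it bounds `cov[X_t, ε_s]` and then `cov[X_t, X_τ]`, which solve Yule–Walker
type recursions in `t`. Their differences from the frozen counterparts solve the recursion with
residuals of order `|t - s| ρ₁ ^ |t - s| / N` (`IsCovSystem.norm_innov_sub_le`,
`IsCovSystem.norm_cov_sub_le`). A slightly larger rate `ρ₂` absorbs the linear factor.

Boundedness of the process enters only qualitatively, to start the iteration, so the a priori bounds
may depend on `p`. -/

/-- `B` is the sequence of coefficients of the inverse of `1 - ∑_{j=1}^d Ψ_j z^j`: it is causal,
decays geometrically and is a two-sided convolution inverse. -/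
structure IsGreenSeq {R : Type*} [NormedRing R] (d : ℕ) (q b : ℝ) (Ψ : ℕ → R) (B : ℤ → R) :
    Prop where
  causal : ∀ n : ℤ, n < 0 → B n = 0
  bound : ∀ n : ℕ, ‖B n‖ ≤ b * q ^ n
  left_inv : ∀ n : ℤ, B n - ∑ j ∈ Finset.Icc 1 d, B (n - j) * Ψ j = if n = 0 then 1 else 0
  right_inv : ∀ n : ℤ, B n - ∑ j ∈ Finset.Icc 1 d, Ψ j * B (n - j) = if n = 0 then 1 else 0

/-! ### Stability of slowly varying autoregressions -/

section Stability

variable {R : Type*} [NormedRing R]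

theorem IsGreenSeq.norm_le {d : ℕ} {q b : ℝ} {Ψ : ℕ → R} {B : ℤ → R}
    (h : IsGreenSeq d q b Ψ B) (n : ℤ) : ‖B n‖ ≤ b * q ^ n.natAbs := by
  rcases lt_or_ge n 0 with hn | hn
  · rw [h.causal n hn, norm_zero]
    exact (norm_nonneg _).trans (h.bound _)
  · obtain ⟨m, rfl⟩ := Int.eq_ofNat_of_zero_le hn
    exact h.bound m

theorem summable_pow_natAbs {q : ℝ} (hq0 : 0 ≤ q) (hq1 : q < 1) :
    Summable fun n : ℤ => q ^ n.natAbs :=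
  Summable.of_nat_of_neg (by simpa using summable_geometric_of_lt_one hq0 hq1)
    (by simpa using summable_geometric_of_lt_one hq0 hq1)

variable [CompleteSpace R]

/-- Boundedness of `Z` makes all the series absolutely convergent, so the lags can be shifted from
`Z` onto `B`. The left inverse identity then collapses the sum to its term at `n = 0`. -/
theorem IsGreenSeq.hasSum_apply {d : ℕ} {q b : ℝ} {Ψ : ℕ → R} {B : ℤ → R}
    (h : IsGreenSeq d q b Ψ B) (hq0 : 0 ≤ q) (hq1 : q < 1) {Z : ℤ → R} {M : ℝ}
    (hZ : ∀ t, ‖Z t‖ ≤ M) (t : ℤ) :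
    HasSum (fun k : ℕ => B k * (Z (t - k) - ∑ j ∈ Finset.Icc 1 d, Ψ j * Z (t - k - j))) (Z t) := by
  have hsB : Summable fun n : ℤ => ‖B n‖ :=
    Summable.of_nonneg_of_le (fun _ => norm_nonneg _) h.norm_le
      ((summable_pow_natAbs hq0 hq1).mul_left b)
  have hs : ∀ (Y : ℤ → R) (M' : ℝ), (∀ n, ‖Y n‖ ≤ M') → Summable fun n => B n * Y n := by
    intro Y M' hY
    refine Summable.of_norm_bounded (hsB.mul_right M') fun n => ?_
    exact (norm_mul_le _ _).trans (mul_le_mul_of_nonneg_left (hY n) (norm_nonneg _))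
  have h1 : HasSum (fun n : ℤ => B n * Z (t - n)) (∑' n, B n * Z (t - n)) :=
    (hs (fun n => Z (t - n)) M fun n => hZ _).hasSum
  -- Reindexing by `n ↦ n - j` leaves the sum unchanged, hence one value `S` for both series.
  have h2 : ∀ j ∈ Finset.Icc 1 d, ∃ S, HasSum (fun n : ℤ => B n * (Ψ j * Z (t - n - j))) S ∧
      HasSum (fun n : ℤ => B (n - j) * Ψ j * Z (t - n)) S := by
    intro j _
    have : Summable fun n : ℤ => B n * (Ψ j * Z (t - n - j)) :=
      hs (fun n => Ψ j * Z (t - n - j)) (‖Ψ j‖ * M) fun n =>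
        (norm_mul_le _ _).trans (mul_le_mul_of_nonneg_left (hZ _) (norm_nonneg _))
    refine ⟨_, this.hasSum, ?_⟩
    have h3 := (Equiv.subRight (j : ℤ)).hasSum_iff.mpr this.hasSum
    have e : (fun n : ℤ => B n * (Ψ j * Z (t - n - j))) ∘ Equiv.subRight (j : ℤ) =
        fun n : ℤ => B (n - j) * Ψ j * Z (t - n) := by
      ext n
      simp [mul_assoc, show t - (n - (j : ℤ)) - j = t - n by ring]
    rwa [e] at h3
  choose! S hS1 hS2 using h2
  have e1 := h1.sub (hasSum_sum hS1)
  have e2 := h1.sub (hasSum_sum hS2)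
  have e3 : HasSum (fun n : ℤ => B n * Z (t - n) -
      ∑ j ∈ Finset.Icc 1 d, B (n - j) * Ψ j * Z (t - n)) (Z t) := by
    have : (fun n : ℤ => B n * Z (t - n) - ∑ j ∈ Finset.Icc 1 d, B (n - j) * Ψ j * Z (t - n))
        = fun n => if n = 0 then Z t else 0 := by
      ext n
      rw [← Finset.sum_mul, ← sub_mul, h.left_inv]
      split_ifs with hn <;> simp [hn]
    rw [this]
    exact hasSum_ite_eq 0 (Z t)
  rw [e2.unique e3] at e1
  -- Causality discards the negative indices.
  have hinj : Function.Injective (fun k : ℕ => (k : ℤ)) := Nat.cast_injective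
  have e4 := (hinj.hasSum_iff (f := fun n : ℤ => B n * Z (t - n) -
      ∑ j ∈ Finset.Icc 1 d, B n * (Ψ j * Z (t - n - j))) (a := Z t) (by
    intro n hn
    have : n < 0 := by
      by_contra hc
      exact hn ⟨n.toNat, by simp; omega⟩
    simp [h.causal n this])).mpr e1
  simpa [Function.comp_def, mul_sub, Finset.mul_sum] using e4

/-- Stability of slowly varying autoregressions: a bounded sequence inherits the geometric weight
of its residuals. -/
theorem stability_step {d : ℕ} {q b ρ κ : ℝ} (hq0 : 0 ≤ q) (hb : 0 ≤ b) (hqρ : q < ρ)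
    (hρ1 : ρ < 1) (hκ : 0 ≤ κ) {Ψ : ℕ → ℤ → R} {B : ℤ → ℤ → R}
    (hB : ∀ t, IsGreenSeq d q b (fun j => Ψ j t) (B t))
    (hΨ : ∀ j ∈ Finset.Icc 1 d, ∀ s t : ℤ, ‖Ψ j s - Ψ j t‖ ≤ κ * |(s : ℝ) - t|)
    {Z : ℤ → R} {φ : ℤ → ℝ} (hφ : ∀ t, 0 ≤ φ t) (hφρ : ∀ t (m : ℕ), ρ ^ m * φ (t - m) ≤ φ t)
    (hW : ∀ t, ‖Z t - ∑ j ∈ Finset.Icc 1 d, Ψ j t * Z (t - j)‖ ≤ φ t)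
    {M₀ M : ℝ} (hM : 0 ≤ M) (hZ₀ : ∀ t, ‖Z t‖ ≤ M₀) (hZ : ∀ t, ‖Z t‖ ≤ M * φ t) (t : ℤ) :
    ‖Z t‖ ≤ (b * ∑' k : ℕ, (q / ρ) ^ k +
      κ * (d * b / ρ ^ d * ∑' k : ℕ, k * (q / ρ) ^ k) * M) * φ t := by
  have hρ0 : 0 < ρ := hq0.trans_lt hqρ
  have hr0 : 0 ≤ q / ρ := by positivity
  have hr1 : q / ρ < 1 := (div_lt_one hρ0).mpr hqρ
  have hφ' : ∀ t (m : ℕ), φ (t - m) ≤ φ t / ρ ^ m := fun t m => by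
    rw [le_div_iff₀ (by positivity), mul_comm]; exact hφρ t m
  have hs1 : Summable fun k : ℕ => (q / ρ) ^ k := summable_geometric_of_lt_one hr0 hr1
  have hs2 : Summable fun k : ℕ => (k : ℝ) * (q / ρ) ^ k := by
    have := summable_pow_mul_geometric_of_norm_lt_one (R := ℝ) 1
      (r := q / ρ) (by rwa [Real.norm_of_nonneg hr0])
    simpa using this
  have key := (hB t).hasSum_apply hq0 (hqρ.trans hρ1) hZ₀ t
  have hsum := ((hs1.hasSum.mul_left b).add
    ((hs2.hasSum.mul_left (d * b / ρ ^ d)).mul_left (κ * M))).mul_right (φ t)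
  have hle := key.norm_le_of_bounded hsum ?_
  · refine hle.trans (le_of_eq ?_)
    ring
  intro k
  -- The frozen residual at time `t - k` is the true residual minus the effect of the coefficient
  -- change over `k` steps.
  have hQ : Z (t - k) - ∑ j ∈ Finset.Icc 1 d, Ψ j t * Z (t - k - j) =
      (Z (t - k) - ∑ j ∈ Finset.Icc 1 d, Ψ j (t - k) * Z (t - k - j)) -
      ∑ j ∈ Finset.Icc 1 d, (Ψ j t - Ψ j (t - k)) * Z (t - k - j) := by
    simp only [sub_mul, Finset.sum_sub_distrib]
    abel
  -- The coefficient change is at most `κ k`; moving the weight from `t - k - j` to `t` costs at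
  -- most `ρ⁻ᵏ ρ⁻ᵈ`, as `j ≤ d`.
  have hE : ‖∑ j ∈ Finset.Icc 1 d, (Ψ j t - Ψ j (t - k)) * Z (t - k - j)‖ ≤
      d * (κ * k * (M * (φ t / (ρ ^ k * ρ ^ d)))) := by
    refine (norm_sum_le_of_le _ (f := fun j => (Ψ j t - Ψ j (t - k)) * Z (t - k - j))
      (n := fun _ => κ * k * (M * (φ t / (ρ ^ k * ρ ^ d)))) fun j hj => ?_).trans ?_
    · refine (norm_mul_le _ _).trans (mul_le_mul ?_ ?_ (norm_nonneg _) (by positivity))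
      · simpa using hΨ j hj t (t - k)
      · refine (hZ _).trans (mul_le_mul_of_nonneg_left ?_ hM)
        have := hφ' t (k + j)
        rw [show t - ((k + j : ℕ) : ℤ) = t - k - j by push_cast; ring] at this
        refine this.trans (div_le_div_of_nonneg_left (hφ t) (by positivity) ?_)
        rw [pow_add]
        exact mul_le_mul_of_nonneg_left
          (pow_le_pow_of_le_one hρ0.le hρ1.le (Finset.mem_Icc.mp hj).2) (by positivity)
    · simp
  have hQn : ‖Z (t - k) - ∑ j ∈ Finset.Icc 1 d, Ψ j t * Z (t - k - j)‖ ≤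
      φ t / ρ ^ k + d * (κ * k * (M * (φ t / (ρ ^ k * ρ ^ d)))) := by
    rw [hQ]
    exact (norm_sub_le _ _).trans (add_le_add ((hW _).trans (hφ' t k)) hE)
  refine (norm_mul_le _ _).trans ((mul_le_mul ((hB t).bound k) hQn (norm_nonneg _)
    (by positivity)).trans (le_of_eq ?_))
  rw [div_pow]
  field_simp

theorem exists_stability (d : ℕ) {q b ρ : ℝ} (hq0 : 0 ≤ q) (hb : 0 ≤ b) (hqρ : q < ρ)
    (hρ1 : ρ < 1) : ∃ c κ₀ : ℝ, 0 ≤ c ∧ 0 < κ₀ ∧ ∀ {R : Type*} [NormedRing R] [CompleteSpace R]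
      (κ : ℝ), 0 ≤ κ → κ ≤ κ₀ → ∀ {Ψ : ℕ → ℤ → R} {B : ℤ → ℤ → R},
      (∀ t, IsGreenSeq d q b (fun j => Ψ j t) (B t)) →
      (∀ j ∈ Finset.Icc 1 d, ∀ s t : ℤ, ‖Ψ j s - Ψ j t‖ ≤ κ * |(s : ℝ) - t|) →
      ∀ {Z : ℤ → R} {φ : ℤ → ℝ}, (∀ t, 0 ≤ φ t) → (∀ t (m : ℕ), ρ ^ m * φ (t - m) ≤ φ t) →
      (∀ t, ‖Z t - ∑ j ∈ Finset.Icc 1 d, Ψ j t * Z (t - j)‖ ≤ φ t) →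
      (∃ M₀, ∀ t, ‖Z t‖ ≤ M₀) → ∀ t, ‖Z t‖ ≤ c * φ t := by
  have hρ0 : 0 < ρ := hq0.trans_lt hqρ
  set c₁ := b * ∑' k : ℕ, (q / ρ) ^ k with hc₁
  set c₂ := d * b / ρ ^ d * ∑' k : ℕ, k * (q / ρ) ^ k with hc₂
  have h1 : 0 ≤ c₁ := mul_nonneg hb (tsum_nonneg fun k => by positivity)
  have h2 : 0 ≤ c₂ := mul_nonneg (by positivity) (tsum_nonneg fun k => by positivity)
  -- This threshold gives `κ c₂ ≤ 1 / 2`; the `+ 1` covers `c₂ = 0`. The fixed point of `M ↦ c₁ + M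
  -- / 2` is `2 c₁`.
  refine ⟨2 * c₁, 1 / (2 * (c₂ + 1)), by positivity, by positivity, ?_⟩
  intro R _ _ κ hκ hκ₀ Ψ B hB hΨ Z φ hφ hφρ hW ⟨M₀, hM₀⟩ t
  have hM₀' : 0 ≤ M₀ := (norm_nonneg _).trans (hM₀ 0)
  have hκc : κ * c₂ ≤ 1 / 2 := by
    rw [le_div_iff₀ (by positivity)] at hκ₀
    nlinarith
  -- The weight `φ` may vanish, so no initial bound `M φ` need exist. Adding `η` supplies one with
  -- `M = M₀ / η`, whose influence is halved at each iteration; `η → 0` comes last.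
  have main : ∀ η : ℝ, 0 < η → ‖Z t‖ ≤ 2 * c₁ * (φ t + η) := by
    intro η hη
    have iter : ∀ (n : ℕ) (t : ℤ), ‖Z t‖ ≤ (2 * c₁ + M₀ / η * (1 / 2) ^ n) * (φ t + η) := by
      intro n
      induction n with
      | zero =>
        intro t
        refine (hM₀ t).trans ?_
        have e : M₀ = M₀ / η * η := by field_simp
        have := hφ t
        calc M₀ = M₀ / η * η := e
          _ ≤ (2 * c₁ + M₀ / η * (1 / 2) ^ 0) * (φ t + η) := by
            rw [pow_zero, mul_one]
            refine mul_le_mul ?_ ?_ hη.le (by positivity) <;> linarith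
      | succ n ih =>
        intro t
        have hη' : ∀ m : ℕ, ρ ^ m * η ≤ η := fun m =>
          mul_le_of_le_one_left hη.le (pow_le_one₀ hρ0.le hρ1.le)
        have := stability_step hq0 hb hqρ hρ1 hκ hB hΨ (φ := fun t => φ t + η)
          (fun t => add_nonneg (hφ t) hη.le)
          (fun t m => by rw [mul_add]; exact add_le_add (hφρ t m) (hη' m))
          (fun t => (hW t).trans (le_add_of_nonneg_right hη.le))
          (M := 2 * c₁ + M₀ / η * (1 / 2) ^ n) (by positivity) hM₀ ih t
        refine this.trans (mul_le_mul_of_nonneg_right ?_ (add_nonneg (hφ t) hη.le))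
        have h3 : 0 ≤ 2 * c₁ + M₀ / η * (1 / 2) ^ n := by positivity
        have := mul_le_mul_of_nonneg_right hκc h3
        rw [pow_succ]
        linarith
    have hlim : Filter.Tendsto (fun n : ℕ => (2 * c₁ + M₀ / η * (1 / 2) ^ n) * (φ t + η))
        Filter.atTop (nhds ((2 * c₁ + M₀ / η * 0) * (φ t + η))) :=
      (((tendsto_pow_atTop_nhds_zero_of_lt_one (by norm_num) (by norm_num)).const_mul _).const_add
        _).mul_const _
    simpa using ge_of_tendsto' hlim fun n => iter n t
  have hlim : Filter.Tendsto (fun η : ℝ => 2 * c₁ * (φ t + η)) (nhdsWithin 0 (Set.Ioi 0))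
      (nhds (2 * c₁ * (φ t + 0))) :=
    (((continuous_const.add continuous_id).const_mul (2 * c₁)).tendsto 0).mono_left
      nhdsWithin_le_nhds
  simpa using ge_of_tendsto hlim (Filter.mem_of_superset self_mem_nhdsWithin fun η hη => main η hη)

end Stability

/-! ### Spectral norms of real and complex matrices -/

section MatrixNorm

variable {n : Type*} [Fintype n] [DecidableEq n]

theorem Matrix.l2_opNorm_le_of_forall {𝕜 : Type*} [RCLike 𝕜] {A : Matrix n n 𝕜} {c : ℝ} (hc : 0 ≤ c)
    (h : ∀ x : n → 𝕜, ‖WithLp.toLp 2 (A *ᵥ x)‖ ≤ c * ‖WithLp.toLp 2 x‖) : ‖A‖ ≤ c := by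
  rw [Matrix.cstar_norm_def]
  refine ContinuousLinearMap.opNorm_le_bound _ hc fun x => ?_
  exact h x.ofLp

theorem Matrix.norm_toLp_mulVec_le {𝕜 : Type*} [RCLike 𝕜] (A : Matrix n n 𝕜) (x : n → 𝕜) :
    ‖WithLp.toLp 2 (A *ᵥ x)‖ ≤ ‖A‖ * ‖WithLp.toLp 2 x‖ :=
  Matrix.l2_opNorm_mulVec A (WithLp.toLp 2 x)

/-- A real matrix acts separately on the real and imaginary parts of a complex vector, and the
squared norms add. -/
theorem Matrix.norm_map_ofReal (A : Matrix n n ℝ) : ‖A.map Complex.ofReal‖ = ‖A‖ := by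
  apply le_antisymm
  · refine Matrix.l2_opNorm_le_of_forall (norm_nonneg _) fun x => ?_
    have hre : ∀ i, ((A.map Complex.ofReal) *ᵥ x) i =
        ⟨(A *ᵥ fun j => (x j).re) i, (A *ᵥ fun j => (x j).im) i⟩ := by
      intro i
      apply Complex.ext <;> simp [Matrix.mulVec, dotProduct]
    have hsq : ∀ y : n → ℂ, ‖WithLp.toLp 2 y‖ ^ 2 =
        ‖WithLp.toLp 2 fun j => (y j).re‖ ^ 2 + ‖WithLp.toLp 2 fun j => (y j).im‖ ^ 2 := by
      intro y
      simp only [EuclideanSpace.norm_sq_eq, ← Finset.sum_add_distrib]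
      refine Finset.sum_congr rfl fun i _ => ?_
      rw [← Complex.normSq_eq_norm_sq, Complex.normSq_apply]
      simp [sq]
    refine le_of_sq_le_sq ?_ (by positivity)
    rw [mul_pow, hsq, hsq x, mul_add]
    simp only [hre]
    rw [← mul_pow, ← mul_pow]
    exact add_le_add (pow_le_pow_left₀ (norm_nonneg _) (A.norm_toLp_mulVec_le _) 2)
      (pow_le_pow_left₀ (norm_nonneg _) (A.norm_toLp_mulVec_le _) 2)
  · refine Matrix.l2_opNorm_le_of_forall (norm_nonneg _) fun x => ?_
    have hn : ∀ y : n → ℝ, ‖WithLp.toLp 2 fun j => (y j : ℂ)‖ = ‖WithLp.toLp 2 y‖ := by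
      intro y
      simp [EuclideanSpace.norm_eq]
    have := (A.map Complex.ofReal).norm_toLp_mulVec_le fun j => (x j : ℂ)
    rw [hn] at this
    rw [← hn (A *ᵥ x)]
    convert this using 3
    funext i
    simp [Matrix.mulVec, dotProduct]

/-- Entrywise conjugation preserves the norm, as conjugating vectors is isometric; the transpose is
the conjugate transpose of the conjugate. -/
theorem Matrix.norm_transpose_complex (A : Matrix n n ℂ) : ‖Aᵀ‖ = ‖A‖ := by
  have hstar : ∀ y : n → ℂ, ‖WithLp.toLp 2 (star y)‖ = ‖WithLp.toLp 2 y‖ := by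
    intro y
    simp [EuclideanSpace.norm_eq]
  have hle : ∀ A : Matrix n n ℂ, ‖A.map star‖ ≤ ‖A‖ := by
    intro A
    refine Matrix.l2_opNorm_le_of_forall (norm_nonneg _) fun x => ?_
    have : A.map star *ᵥ x = star (A *ᵥ star x) := by
      ext i
      simp [Matrix.mulVec, dotProduct]
    rw [this, hstar, ← hstar x]
    exact A.norm_toLp_mulVec_le _
  have h : ‖A.map star‖ = ‖A‖ := by
    refine le_antisymm (hle A) ?_
    have := hle (A.map star)
    rwa [Matrix.map_map, show (star : ℂ → ℂ) ∘ star = id from funext star_star,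
      Matrix.map_id] at this
  rw [← h, ← Matrix.l2_opNorm_conjTranspose (A.map star)]
  congr 1
  ext i j
  simp

theorem Matrix.norm_le_sum_norm_entry (A : Matrix n n ℂ) :
    ‖A‖ ≤ ∑ i, ∑ j, ‖A i j‖ * ‖Matrix.single i j (1 : ℂ)‖ := by
  conv_lhs => rw [Matrix.matrix_eq_sum_single A]
  refine (norm_sum_le _ _).trans (Finset.sum_le_sum fun i _ => (norm_sum_le _ _).trans
    (Finset.sum_le_sum fun j _ => ?_))
  rw [← norm_smul, Matrix.smul_single, smul_eq_mul, mul_one]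

theorem Matrix.norm_entry_le {𝕜 : Type*} [RCLike 𝕜] (A : Matrix n n 𝕜) (i j : n) :
    ‖A i j‖ ≤ ‖A‖ := by
  have h := A.norm_toLp_mulVec_le (Pi.single j (1 : 𝕜))
  have h2 : ‖WithLp.toLp 2 (Pi.single j 1 : n → 𝕜)‖ = 1 := by
    simp
  rw [h2, mul_one] at h
  refine le_trans ?_ h
  simpa using PiLp.norm_apply_le (WithLp.toLp 2 (A *ᵥ Pi.single j 1)) i

end MatrixNorm

/-! ### Inverting the autoregressive polynomial -/

section Inverse

variable {p : ℕ}

theorem MinSingularValueGE.isUnit {A : Matrix (Fin p) (Fin p) ℂ} {γ : ℝ} (hγ : 0 < γ)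
    (h : MinSingularValueGE A γ) : IsUnit A := by
  rw [← Matrix.mulVec_injective_iff_isUnit]
  rw [← Matrix.coe_mulVecLin, injective_iff_map_eq_zero]
  intro x hx
  have := h (WithLp.toLp 2 x)
  rw [Matrix.toEuclideanCLM_toLp, show A *ᵥ x = 0 from hx] at this
  simp only [WithLp.toLp_zero, norm_zero] at this
  have h0 : ‖WithLp.toLp 2 x‖ = 0 := le_antisymm (by nlinarith) (norm_nonneg _)
  simpa using h0

theorem MinSingularValueGE.norm_inv_le {A : Matrix (Fin p) (Fin p) ℂ} {γ : ℝ} (hγ : 0 < γ)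
    (h : MinSingularValueGE A γ) : ‖A⁻¹‖ ≤ γ⁻¹ := by
  refine Matrix.l2_opNorm_le_of_forall (by positivity) fun x => ?_
  have := h (WithLp.toLp 2 (A⁻¹ *ᵥ x))
  rw [Matrix.toEuclideanCLM_toLp, Matrix.mulVec_mulVec, Matrix.mul_nonsing_inv _
    ((Matrix.isUnit_iff_isUnit_det _).mp (h.isUnit hγ)), Matrix.one_mulVec] at this
  rw [inv_mul_eq_div, le_div_iff₀ hγ, mul_comm]
  exact this

theorem differentiable_arPoly (d : ℕ) (Φ : ℕ → ℝ → Matrix (Fin p) (Fin p) ℝ) (u : ℝ) :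
    Differentiable ℂ (arPoly d Φ u) := by
  unfold arPoly
  fun_prop

theorem differentiableAt_arPoly_inv {d : ℕ} {Φ : ℕ → ℝ → Matrix (Fin p) (Fin p) ℝ} {u : ℝ} {z : ℂ}
    (h : IsUnit (arPoly d Φ u z)) : DifferentiableAt ℂ (fun z => (arPoly d Φ u z)⁻¹) z := by
  simp only [Matrix.nonsing_inv_eq_ringInverse]
  obtain ⟨a, ha⟩ := h
  have h1 : DifferentiableAt ℂ Ring.inverse (arPoly d Φ u z) := by
    rw [← ha]; exact differentiableAt_inverse a.isUnit
  exact h1.comp z (differentiable_arPoly d Φ u z)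

end Inverse

/-! ### Laurent coefficients on the unit circle -/

section LaurentCoeff

variable {E : Type*} [NormedAddCommGroup E] [NormedSpace ℂ E]

/-- The `n`-th Laurent coefficient on the unit circle. -/
noncomputable def laurentCoeff (g : ℂ → E) (n : ℤ) : E :=
  (2 * Real.pi * Complex.I : ℂ)⁻¹ • ∮ z in C(0, 1), z ^ (-n - 1) • g z

theorem continuousOn_zpow_sphere (n : ℤ) {R : ℝ} (hR : 0 < R) :
    ContinuousOn (fun z : ℂ => z ^ n) (Metric.sphere 0 R) := fun z hz =>
  (continuousAt_zpow₀ z n (Or.inl fun h => by simp [h] at hz; linarith)).continuousWithinAt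

theorem circleIntegrable_zpow_smul {g : ℂ → E} (hg : ContinuousOn g (Metric.sphere 0 1)) (n : ℤ) :
    CircleIntegrable (fun z => z ^ n • g z) 0 1 :=
  ((continuousOn_zpow_sphere n one_pos).smul hg).circleIntegrable zero_le_one

theorem laurentCoeff_congr {f g : ℂ → E} (h : ∀ z : ℂ, ‖z‖ = 1 → f z = g z) (n : ℤ) :
    laurentCoeff f n = laurentCoeff g n := by
  unfold laurentCoeff
  congr 1
  refine circleIntegral.integral_congr zero_le_one fun z hz => ?_
  rw [h z (by simpa using hz)]

theorem laurentCoeff_sub {f g : ℂ → E} (hf : ContinuousOn f (Metric.sphere 0 1))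
    (hg : ContinuousOn g (Metric.sphere 0 1)) (n : ℤ) :
    laurentCoeff (fun z => f z - g z) n = laurentCoeff f n - laurentCoeff g n := by
  simp only [laurentCoeff, smul_sub]
  rw [circleIntegral.integral_sub (circleIntegrable_zpow_smul hf _)
    (circleIntegrable_zpow_smul hg _), smul_sub]

theorem laurentCoeff_sum {ι : Type*} (s : Finset ι) {f : ι → ℂ → E}
    (hf : ∀ i ∈ s, ContinuousOn (f i) (Metric.sphere 0 1)) (n : ℤ) :
    laurentCoeff (fun z => ∑ i ∈ s, f i z) n = ∑ i ∈ s, laurentCoeff (f i) n := by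
  simp only [laurentCoeff, Finset.smul_sum]
  rw [circleIntegral.integral_fun_sum fun i hi => circleIntegrable_zpow_smul (hf i hi) _,
    Finset.smul_sum]

theorem laurentCoeff_zpow_smul (g : ℂ → E) (m n : ℤ) :
    laurentCoeff (fun z => z ^ m • g z) n = laurentCoeff g (n - m) := by
  unfold laurentCoeff
  congr 1
  refine circleIntegral.integral_congr zero_le_one fun z hz => ?_
  have hz0 : z ≠ 0 := fun h => by simp [h] at hz
  simp only [smul_smul]
  rw [← zpow_add₀ hz0]
  congr 2
  ring

theorem laurentCoeff_map {F : Type*} [NormedAddCommGroup F] [NormedSpace ℂ F] [CompleteSpace E]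
    [CompleteSpace F] (L : E →L[ℂ] F) {g : ℂ → E} (hg : ContinuousOn g (Metric.sphere 0 1)) (n : ℤ) :
    laurentCoeff (fun z => L (g z)) n = L (laurentCoeff g n) := by
  unfold laurentCoeff circleIntegral
  rw [map_smul, ← ContinuousLinearMap.intervalIntegral_comp_comm L
    (circleIntegrable_zpow_smul hg _).out]
  simp

theorem norm_laurentCoeff_le {g : ℂ → E} {c : ℝ} (h : ∀ z : ℂ, ‖z‖ = 1 → ‖g z‖ ≤ c) (n : ℤ) :
    ‖laurentCoeff g n‖ ≤ c := by
  have := circleIntegral.norm_two_pi_i_inv_smul_integral_le_of_norm_le_const (E := E) (c := 0)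
    (R := 1) (C := c) (f := fun z => z ^ (-n - 1) • g z) zero_le_one fun z hz => by
      have hz : ‖z‖ = 1 := by simpa using hz
      rw [norm_smul, norm_zpow, hz, one_zpow, one_mul]
      exact h z hz
  simpa [laurentCoeff] using this

theorem laurentCoeff_const [CompleteSpace E] (a : E) (n : ℤ) :
    laurentCoeff (fun _ => a) n = if n = 0 then a else 0 := by
  unfold laurentCoeff
  rw [circleIntegral.integral_smul_const]
  split_ifs with hn
  · have := circleIntegral.integral_sub_center_inv 0 (R := 1) one_ne_zero
    simp only [sub_zero] at this
    rw [hn, neg_zero, zero_sub]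
    simp only [zpow_neg_one]
    rw [this, smul_smul, inv_mul_cancel₀ Complex.two_pi_I_ne_zero, one_smul]
  · have := circleIntegral.integral_sub_zpow_of_ne (n := -n - 1) (by omega) 0 0 1
    simp only [sub_zero] at this
    simp [this]

theorem laurentCoeff_eq_zero_of_differentiableOn {g : ℂ → E}
    (hg : ∀ z : ℂ, ‖z‖ ≤ 1 → DifferentiableAt ℂ g z) {n : ℤ} (hn : n < 0) :
    laurentCoeff g n = 0 := by
  unfold laurentCoeff
  obtain ⟨m, hm⟩ := Int.eq_ofNat_of_zero_le (show 0 ≤ -n - 1 by omega)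
  have hd : ∀ z : ℂ, ‖z‖ ≤ 1 → DifferentiableAt ℂ (fun z => z ^ (-n - 1) • g z) z := by
    intro z hz
    simp only [hm, zpow_natCast]
    exact (differentiableAt_id.pow m).smul (hg z hz)
  rw [Complex.circleIntegral_eq_zero_of_differentiable_on_off_countable zero_le_one
    Set.countable_empty (fun z hz => (hd z (by simpa using hz)).continuousAt.continuousWithinAt)
    (fun z hz => hd z (by simpa using (Metric.ball_subset_closedBall hz.1))), smul_zero]

/-- Cauchy's estimate: the contour moves from the unit circle to radius `r` without changing the
integral. -/
theorem norm_laurentCoeff_le_pow {g : ℂ → E} {r c : ℝ} (hr : 1 ≤ r)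
    (hg : ∀ z : ℂ, ‖z‖ ≤ r → DifferentiableAt ℂ g z) (hc : ∀ z : ℂ, ‖z‖ ≤ r → ‖g z‖ ≤ c) (n : ℕ) :
    ‖laurentCoeff g n‖ ≤ c * (r⁻¹) ^ n := by
  have hr0 : 0 < r := by linarith
  have hd : ∀ z : ℂ, z ≠ 0 → ‖z‖ ≤ r → DifferentiableAt ℂ (fun z => z ^ (-(n : ℤ) - 1) • g z) z :=
    fun z hz hzr => (differentiableAt_zpow.mpr (Or.inl hz)).smul (hg z hzr)
  have hne : ∀ z : ℂ, z ∉ Metric.ball (0 : ℂ) 1 → z ≠ 0 := fun z hz h => hz (by simp [h])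
  unfold laurentCoeff
  rw [← Complex.circleIntegral_eq_of_differentiable_on_annulus_off_countable one_pos hr
    Set.countable_empty
    (fun z hz => (hd z (hne z hz.2) (by simpa using hz.1)).continuousAt.continuousWithinAt)
    (fun z hz => hd z (hne z fun h => hz.1.2 (Metric.ball_subset_closedBall h))
      (by simpa using (Metric.ball_subset_closedBall hz.1.1)))]
  have := circleIntegral.norm_two_pi_i_inv_smul_integral_le_of_norm_le_const (E := E) (c := 0)
    (R := r) (C := c * r⁻¹ ^ (n + 1)) (f := fun z => z ^ (-(n : ℤ) - 1) • g z) hr0.le fun z hz => by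
      have hz : ‖z‖ = r := by simpa using hz
      rw [norm_smul, norm_zpow, hz, mul_comm, show -(n : ℤ) - 1 = -((n + 1 : ℕ) : ℤ) by push_cast; ring,
        zpow_neg, zpow_natCast, ← inv_pow]
      exact mul_le_mul_of_nonneg_right (hc z hz.le) (by positivity)
  refine this.trans (le_of_eq ?_)
  rw [pow_succ]
  field_simp

end LaurentCoeff

/-- Multiplication by a power of `z` is a lag of the coefficients, which turns identities between
functions into recursions. -/
theorem laurentCoeff_autoregression {E : Type*} [NormedAddCommGroup E] [NormedSpace ℂ E]
    [CompleteSpace E] {g : ℂ → E} (hg : ContinuousOn g (Metric.sphere 0 1)) (s : Finset ℕ)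
    (L : ℕ → E →L[ℂ] E) (e : ℕ → ℤ) (n : ℤ) :
    laurentCoeff (fun z => g z - ∑ j ∈ s, z ^ e j • L j (g z)) n =
      laurentCoeff g n - ∑ j ∈ s, L j (laurentCoeff g (n - e j)) := by
  have hL : ∀ j, ContinuousOn (fun z => L j (g z)) (Metric.sphere 0 1) := fun j =>
    (L j).continuous.comp_continuousOn hg
  have hzL : ∀ j, ContinuousOn (fun z => z ^ e j • L j (g z)) (Metric.sphere 0 1) := fun j =>
    (continuousOn_zpow_sphere _ one_pos).smul (hL j)
  rw [laurentCoeff_sub hg (continuousOn_finsetSum _ fun j _ => hzL j),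
    laurentCoeff_sum _ fun j _ => hzL j]
  congr 1
  refine Finset.sum_congr rfl fun j _ => ?_
  rw [laurentCoeff_zpow_smul, laurentCoeff_map (L j) hg]

/-- The coefficient of `z ^ n` in the power series of `A(u, z)⁻¹`. -/
noncomputable def arGreen {p : ℕ} (d : ℕ) (Φ : ℕ → ℝ → Matrix (Fin p) (Fin p) ℝ) (u : ℝ) (n : ℤ) :
    Matrix (Fin p) (Fin p) ℂ :=
  laurentCoeff (fun z => (arPoly d Φ u z)⁻¹) n

/-- The local spectral density as a function of `z = e^{iω}`. -/
noncomputable def spectralSymbol {p : ℕ} (d : ℕ) (Φ : ℕ → ℝ → Matrix (Fin p) (Fin p) ℝ)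
    (Sig : ℝ → Matrix (Fin p) (Fin p) ℝ) (u : ℝ) (z : ℂ) : Matrix (Fin p) (Fin p) ℂ :=
  (arPoly d Φ u z⁻¹)⁻¹ * (Sig u).map Complex.ofReal * ((arPoly d Φ u z)⁻¹)ᵀ

/-! ### The model with coefficients frozen at `u` -/

section Frozen

variable {p d : ℕ} {K δ γ σ₁ σ₂ : ℝ} {Φ : ℕ → ℝ → Matrix (Fin p) (Fin p) ℝ}
  {Sig : ℝ → Matrix (Fin p) (Fin p) ℝ}

theorem TVVARCoefficients.isUnit_arPoly (h : TVVARCoefficients d K δ γ σ₁ σ₂ Φ Sig) (hγ : 0 < γ)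
    (u : ℝ) {z : ℂ} (hz : ‖z‖ ≤ 1 + δ) : IsUnit (arPoly d Φ u z) :=
  (h.root u z hz).isUnit hγ

theorem TVVARCoefficients.continuousOn_inv (h : TVVARCoefficients d K δ γ σ₁ σ₂ Φ Sig) (hδ : 0 < δ)
    (hγ : 0 < γ) (u : ℝ) :
    ContinuousOn (fun z => (arPoly d Φ u z)⁻¹) (Metric.sphere 0 1) := fun z hz =>
  (differentiableAt_arPoly_inv (h.isUnit_arPoly hγ u (by
    have : ‖z‖ = 1 := by simpa using hz
    linarith))).continuousAt.continuousWithinAt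

/-- The inverse is holomorphic and bounded by `γ⁻¹` on the disc of radius `1 + δ`; the two
convolution identities are the coefficients of `A⁻¹ A = 1` and `A A⁻¹ = 1`. -/
theorem TVVARCoefficients.isGreenSeq (h : TVVARCoefficients d K δ γ σ₁ σ₂ Φ Sig) (hδ : 0 < δ)
    (hγ : 0 < γ) (u : ℝ) :
    IsGreenSeq d (1 + δ)⁻¹ γ⁻¹ (fun j => (Φ j u).map Complex.ofReal) (arGreen d Φ u) where
  causal n hn := laurentCoeff_eq_zero_of_differentiableOn
    (fun z hz => differentiableAt_arPoly_inv (h.isUnit_arPoly hγ u (by linarith))) hn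
  bound n := norm_laurentCoeff_le_pow (by linarith)
    (fun z hz => differentiableAt_arPoly_inv (h.isUnit_arPoly hγ u hz))
    (fun z hz => (h.root u z hz).norm_inv_le hγ) n
  left_inv n := by
    rw [← laurentCoeff_const]
    have := laurentCoeff_autoregression (h.continuousOn_inv hδ hγ u) (Finset.Icc 1 d)
      (fun j => (ContinuousLinearMap.mul ℂ (Matrix (Fin p) (Fin p) ℂ)).flip
        ((Φ j u).map Complex.ofReal)) (fun j => j) n
    simp only [ContinuousLinearMap.flip_apply, ContinuousLinearMap.mul_apply'] at this
    rw [arGreen]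
    simp only [arGreen]
    rw [← this]
    refine laurentCoeff_congr (fun z hz => ?_) n
    have hu := h.isUnit_arPoly hγ u (z := z) (by linarith)
    rw [← Matrix.nonsing_inv_mul _ ((Matrix.isUnit_iff_isUnit_det _).mp hu)]
    conv_rhs => rw [arPoly]
    rw [mul_sub, mul_one, Finset.mul_sum]
    simp [arPoly]
  right_inv n := by
    rw [← laurentCoeff_const]
    have := laurentCoeff_autoregression (h.continuousOn_inv hδ hγ u) (Finset.Icc 1 d)
      (fun j => (ContinuousLinearMap.mul ℂ (Matrix (Fin p) (Fin p) ℂ))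
        ((Φ j u).map Complex.ofReal)) (fun j => j) n
    simp only [ContinuousLinearMap.mul_apply'] at this
    simp only [arGreen]
    rw [← this]
    refine laurentCoeff_congr (fun z hz => ?_) n
    have hu := h.isUnit_arPoly hγ u (z := z) (by linarith)
    rw [← Matrix.mul_nonsing_inv _ ((Matrix.isUnit_iff_isUnit_det _).mp hu)]
    nth_rw 3 [arPoly]
    rw [sub_mul, one_mul, Finset.sum_mul]
    simp [arPoly]

theorem TVVARCoefficients.continuousOn_spectralSymbol
    (h : TVVARCoefficients d K δ γ σ₁ σ₂ Φ Sig) (hδ : 0 < δ) (hγ : 0 < γ) (u : ℝ) :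
    ContinuousOn (spectralSymbol d Φ Sig u) (Metric.sphere 0 1) := by
  have h1 := h.continuousOn_inv hδ hγ u
  have h2 : ContinuousOn (fun z : ℂ => (arPoly d Φ u z⁻¹)⁻¹) (Metric.sphere 0 1) :=
    h1.comp (continuousOn_inv₀.mono fun z hz h0 => by simp [Set.mem_singleton_iff.mp h0] at hz)
      fun z hz => by simpa using hz
  have h3 : ContinuousOn (fun z : ℂ => ((arPoly d Φ u z)⁻¹)ᵀ) (Metric.sphere 0 1) :=
    (continuous_id.matrix_transpose).comp_continuousOn h1
  exact (h2.mul continuousOn_const).mul h3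

/-- Substitute `z = e^{iω}`, `dω = dz / (i z)`. The index is `-r` because the `n`-th coefficient
integrates against `z ^ (-n - 1)`. -/
theorem TVVARCoefficients.localAutocov_eq_laurentCoeff
    (h : TVVARCoefficients d K δ γ σ₁ σ₂ Φ Sig) (hδ : 0 < δ) (hγ : 0 < γ) (r : ℤ) (u : ℝ) :
    localAutocov d Φ Sig r u = laurentCoeff (spectralSymbol d Φ Sig u) (-r) := by
  ext a b
  have := laurentCoeff_map (LinearMap.toContinuousLinearMap (Matrix.entryLinearMap ℂ ℂ a b))
    (h.continuousOn_spectralSymbol hδ hγ u) (-r)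
  simp only [LinearMap.coe_toContinuousLinearMap', Matrix.entryLinearMap_apply] at this
  rw [← this]
  unfold localAutocov laurentCoeff circleIntegral
  rw [Matrix.of_apply, mul_inv (2 * Real.pi : ℂ) Complex.I, smul_eq_mul,
    mul_assoc (2 * Real.pi : ℂ)⁻¹, ← intervalIntegral.integral_const_mul Complex.I⁻¹]
  congr 1
  apply intervalIntegral.integral_congr
  intro θ _
  have hz : circleMap 0 1 θ = Complex.exp (Complex.I * θ) := by
    simp [circleMap, mul_comm]
  have hz1 : Complex.exp (-Complex.I * θ) = (circleMap 0 1 θ)⁻¹ := by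
    rw [hz, ← Complex.exp_neg, neg_mul]
  have hz2 : Complex.exp (Complex.I * r * θ) = circleMap 0 1 θ ^ r := by
    rw [hz, ← Complex.exp_int_mul]
    ring_nf
  have hne : circleMap 0 1 θ ≠ 0 := by simp [circleMap]
  simp only [localSpectralDensity, hz1, hz2, ← hz, deriv_circleMap, smul_eq_mul, spectralSymbol,
    neg_neg]
  rw [zpow_sub_one₀ hne]
  field_simp [Complex.I_ne_zero]

/-- Multiplying the symbol by `A(u, z⁻¹)` cancels its left factor and leaves `Σ(u) (A(u, z)⁻¹)ᵀ`.
The power `z⁻ʲ` shifts the index `-r` to `-(r - j)`. -/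
theorem TVVARCoefficients.localAutocov_autoregression
    (h : TVVARCoefficients d K δ γ σ₁ σ₂ Φ Sig) (hδ : 0 < δ) (hγ : 0 < γ) (r : ℤ) (u : ℝ) :
    localAutocov d Φ Sig r u -
      ∑ j ∈ Finset.Icc 1 d, (Φ j u).map Complex.ofReal * localAutocov d Φ Sig (r - j) u =
      (Sig u).map Complex.ofReal * (arGreen d Φ u (-r))ᵀ := by
  simp only [h.localAutocov_eq_laurentCoeff hδ hγ]
  have := laurentCoeff_autoregression (h.continuousOn_spectralSymbol hδ hγ u) (Finset.Icc 1 d)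
    (fun j => (ContinuousLinearMap.mul ℂ (Matrix (Fin p) (Fin p) ℂ))
      ((Φ j u).map Complex.ofReal)) (fun j => -j) (-r)
  simp only [ContinuousLinearMap.mul_apply'] at this
  have e : ∀ j : ℕ, -(r - (j : ℤ)) = -r - -(j : ℤ) := fun j => by ring
  simp only [e]
  rw [← this]
  have h2 := laurentCoeff_map (((ContinuousLinearMap.mul ℂ (Matrix (Fin p) (Fin p) ℂ))
      ((Sig u).map Complex.ofReal)).comp (LinearMap.toContinuousLinearMap
      (Matrix.transposeLinearEquiv (Fin p) (Fin p) ℂ ℂ).toLinearMap))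
    (h.continuousOn_inv hδ hγ u) (-r)
  rw [arGreen]
  refine Eq.trans ?_ h2
  refine laurentCoeff_congr (fun z hz => ?_) _
  have hu := h.isUnit_arPoly hγ u (z := z⁻¹) (by rw [norm_inv, hz]; linarith)
  have hinv := Matrix.mul_nonsing_inv _ ((Matrix.isUnit_iff_isUnit_det _).mp hu)
  calc _ = arPoly d Φ u z⁻¹ * spectralSymbol d Φ Sig u z := by
        conv_rhs => rw [arPoly]
        rw [sub_mul, one_mul, Finset.sum_mul]
        simp
    _ = _ := by
        rw [spectralSymbol, ← mul_assoc, ← mul_assoc, hinv, one_mul]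
        rfl

/-- The absolute value covers `p = 0`, where the spectrum is empty and `σ₂` may be negative. -/
theorem TVVARCoefficients.norm_sig_le (h : TVVARCoefficients d K δ γ σ₁ σ₂ Φ Sig) (hσ : 0 < σ₁)
    (u : ℝ) : ‖Sig u‖ ≤ |σ₂| := by
  have hsa : IsSelfAdjoint (Sig u) := (h.posDef u).isHermitian
  rw [← cfc_id ℝ (Sig u)]
  refine norm_cfc_le (abs_nonneg _) fun x hx => ?_
  have := h.eigenvalues_mem u hx
  rw [id, Real.norm_of_nonneg (hσ.le.trans this.1)]
  exact this.2.trans (le_abs_self _)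

theorem TVVARCoefficients.sqrt_sig_mul_sqrt_sig (h : TVVARCoefficients d K δ γ σ₁ σ₂ Φ Sig)
    (u : ℝ) : CFC.sqrt (Sig u) * (CFC.sqrt (Sig u))ᵀ = Sig u := by
  have hsa : (CFC.sqrt (Sig u))ᴴ = CFC.sqrt (Sig u) :=
    (IsSelfAdjoint.of_nonneg (CFC.sqrt_nonneg (Sig u))).star_eq
  rw [Matrix.conjTranspose_eq_transpose_of_trivial] at hsa
  rw [hsa]
  exact CFC.sqrt_mul_sqrt_self (Sig u) (Matrix.nonneg_iff_posSemidef.mpr (h.posDef u).posSemidef)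

theorem TVVARCoefficients.norm_sqrt_sig_le (h : TVVARCoefficients d K δ γ σ₁ σ₂ Φ Sig)
    (hσ : 0 < σ₁) (u : ℝ) : ‖CFC.sqrt (Sig u)‖ ≤ √|σ₂| := by
  refine Real.le_sqrt_of_sq_le ?_
  have := Matrix.l2_opNorm_conjTranspose_mul_self (CFC.sqrt (Sig u))ᴴ
  rw [Matrix.conjTranspose_conjTranspose, Matrix.l2_opNorm_conjTranspose,
    Matrix.conjTranspose_eq_transpose_of_trivial, h.sqrt_sig_mul_sqrt_sig] at this
  rw [sq, ← this]
  exact h.norm_sig_le hσ u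

theorem TVVARCoefficients.norm_localAutocov_le
    (h : TVVARCoefficients d K δ γ σ₁ σ₂ Φ Sig) (hδ : 0 < δ) (hγ : 0 < γ) (hσ : 0 < σ₁) (r : ℤ)
    (u : ℝ) : ‖localAutocov d Φ Sig r u‖ ≤ γ⁻¹ * |σ₂| * γ⁻¹ := by
  rw [h.localAutocov_eq_laurentCoeff hδ hγ]
  refine norm_laurentCoeff_le (fun z hz => ?_) _
  have h1 := (h.root u z (by linarith)).norm_inv_le hγ
  have h2 := (h.root u z⁻¹ (by rw [norm_inv, hz]; linarith)).norm_inv_le hγ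
  have h3 : ‖(Sig u).map Complex.ofReal‖ ≤ |σ₂| :=
    (Matrix.norm_map_ofReal (Sig u)).trans_le (h.norm_sig_le hσ u)
  rw [← Matrix.norm_transpose_complex] at h1
  calc ‖spectralSymbol d Φ Sig u z‖
      ≤ ‖(arPoly d Φ u z⁻¹)⁻¹‖ * ‖(Sig u).map Complex.ofReal‖ * ‖((arPoly d Φ u z)⁻¹)ᵀ‖ :=
        (norm_mul_le _ _).trans (mul_le_mul_of_nonneg_right (norm_mul_le _ _) (norm_nonneg _))
    _ ≤ γ⁻¹ * |σ₂| * γ⁻¹ := by gcongr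

end Frozen

/-- `c` and `κ₀` are stability constants for the rate `ρ`: along any parameter path that moves by at
most `κ₀` per step, bounded sequences are dominated by `c` times any weight that dominates their
autoregressive residuals and decays no faster than `ρ`. -/
def IsStableRate (d : ℕ) (K δ γ σ₁ σ₂ ρ c κ₀ : ℝ) : Prop :=
  ∀ (p : ℕ) (Φ : ℕ → ℝ → Matrix (Fin p) (Fin p) ℝ) (Sig : ℝ → Matrix (Fin p) (Fin p) ℝ),
    TVVARCoefficients d K δ γ σ₁ σ₂ Φ Sig → ∀ (x : ℤ → ℝ) (κ : ℝ), 0 ≤ κ → κ ≤ κ₀ →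
    (∀ s t : ℤ, |x s - x t| ≤ κ * |(s : ℝ) - t|) →
    ∀ (Z : ℤ → Matrix (Fin p) (Fin p) ℂ) (φ : ℤ → ℝ), (∀ t, 0 ≤ φ t) →
    (∀ t (m : ℕ), ρ ^ m * φ (t - m) ≤ φ t) →
    (∀ t, ‖Z t - ∑ j ∈ Finset.Icc 1 d, (Φ j (x t)).map Complex.ofReal * Z (t - j)‖ ≤ φ t) →
    (∃ M₀, ∀ t, ‖Z t‖ ≤ M₀) → ∀ t, ‖Z t‖ ≤ c * φ t

/-! ### Uniform constants: decay and Lipschitz dependence on the parameter -/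

section Constants

variable {p d : ℕ} {K δ γ σ₁ σ₂ : ℝ} {Φ : ℕ → ℝ → Matrix (Fin p) (Fin p) ℝ}
  {Sig : ℝ → Matrix (Fin p) (Fin p) ℝ}

theorem TVVARCoefficients.norm_coeff_sub_le (h : TVVARCoefficients d K δ γ σ₁ σ₂ Φ Sig) {j : ℕ}
    (hj : j ∈ Finset.Icc 1 d) (u v : ℝ) :
    ‖(Φ j u).map Complex.ofReal - (Φ j v).map Complex.ofReal‖ ≤ |K| * |u - v| := by
  have e : (Φ j u).map Complex.ofReal - (Φ j v).map Complex.ofReal =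
      (Φ j u - Φ j v).map Complex.ofReal := by
    ext a b; simp
  rw [e]
  exact (Matrix.norm_map_ofReal _).trans_le ((h.lipschitz_coeff j hj u v).trans
    (mul_le_mul_of_nonneg_right (le_abs_self K) (abs_nonneg _)))

theorem TVVARCoefficients.norm_sig_sub_le (h : TVVARCoefficients d K δ γ σ₁ σ₂ Φ Sig) (u v : ℝ) :
    ‖(Sig u).map Complex.ofReal - (Sig v).map Complex.ofReal‖ ≤ |K| * |u - v| := by
  have e : (Sig u).map Complex.ofReal - (Sig v).map Complex.ofReal =
      (Sig u - Sig v).map Complex.ofReal := by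
    ext a b; simp
  rw [e]
  exact (Matrix.norm_map_ofReal _).trans_le ((h.lipschitz_var u v).trans
    (mul_le_mul_of_nonneg_right (le_abs_self K) (abs_nonneg _)))

theorem exists_isStableRate (d : ℕ) (K σ₁ σ₂ : ℝ) {δ γ ρ : ℝ} (hδ : 0 < δ) (hγ : 0 < γ)
    (hρ : (1 + δ)⁻¹ < ρ) (hρ1 : ρ < 1) :
    ∃ c κ₀ : ℝ, 0 ≤ c ∧ 0 < κ₀ ∧ IsStableRate d K δ γ σ₁ σ₂ ρ c κ₀ := by
  obtain ⟨c, κ₀, hc, hκ₀, H⟩ := exists_stability d (q := (1 + δ)⁻¹) (b := γ⁻¹)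
    (by positivity) (by positivity) hρ hρ1
  -- A path moving by `κ` per step moves the coefficients by at most `|K| κ`; the `+ 1` keeps the
  -- divisor positive.
  refine ⟨c, κ₀ / (|K| + 1), hc, by positivity, ?_⟩
  intro p Φ Sig h x κ hκ hκle hx Z φ hφ hφρ hW hZ
  rw [le_div_iff₀ (by positivity)] at hκle
  refine H (κ * (|K| + 1)) (by positivity) hκle
    (Ψ := fun j t => (Φ j (x t)).map Complex.ofReal) (B := fun t => arGreen d Φ (x t))
    (fun t => h.isGreenSeq hδ hγ (x t)) (fun j hj s t => ?_) hφ hφρ hW hZ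
  refine (h.norm_coeff_sub_le hj _ _).trans ?_
  have h1 := mul_le_mul_of_nonneg_left (hx s t) (abs_nonneg K)
  have h2 : 0 ≤ κ * |(s : ℝ) - t| := by positivity
  nlinarith

/-- By the triangle inequality the two-sided weight `ρ ^ |t - s|` is admissible for the stability
principle. -/
theorem pow_mul_pow_natAbs_le {ρ : ℝ} (hρ0 : 0 ≤ ρ) (hρ1 : ρ ≤ 1) (t s : ℤ) (m : ℕ) :
    ρ ^ m * ρ ^ (t - m - s).natAbs ≤ ρ ^ (t - s).natAbs := by
  rw [← pow_add]
  exact pow_le_pow_of_le_one hρ0 hρ1 (by omega)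

theorem pow_natAbs_sub_le {ρ : ℝ} (hρ0 : 0 < ρ) (hρ1 : ρ ≤ 1) (t : ℤ) {d j : ℕ} (hj : j ≤ d) :
    ρ ^ (t - j).natAbs ≤ ρ ^ t.natAbs / ρ ^ d := by
  rw [le_div_iff₀ (by positivity), ← pow_add]
  exact pow_le_pow_of_le_one hρ0.le hρ1 (by omega)

theorem norm_sum_mul_le {R : Type*} [NormedRing R] {d : ℕ} {ρ e g : ℝ} (hρ0 : 0 < ρ) (hρ1 : ρ ≤ 1)
    (he : 0 ≤ e) (hg : 0 ≤ g) {E : ℕ → R} (hE : ∀ j ∈ Finset.Icc 1 d, ‖E j‖ ≤ e) {G : ℤ → R}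
    (hG : ∀ n, ‖G n‖ ≤ g * ρ ^ n.natAbs) (n : ℤ) :
    ‖∑ j ∈ Finset.Icc 1 d, E j * G (n - j)‖ ≤ d * g / ρ ^ d * e * ρ ^ n.natAbs := by
  refine (norm_sum_le_of_le _ (f := fun j => E j * G (n - j))
    (n := fun _ => e * (g * (ρ ^ n.natAbs / ρ ^ d))) fun j hj => ?_).trans ?_
  · refine (norm_mul_le _ _).trans (mul_le_mul (hE j hj) ((hG _).trans ?_) (norm_nonneg _) he)
    exact mul_le_mul_of_nonneg_left (pow_natAbs_sub_le hρ0 hρ1 n (Finset.mem_Icc.mp hj).2) hg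
  · simp only [Finset.sum_const, Nat.card_Icc, nsmul_eq_mul, Nat.add_sub_cancel]
    exact le_of_eq (by ring)

theorem IsStableRate.frozen {ρ c κ₀ : ℝ} (hS : IsStableRate d K δ γ σ₁ σ₂ ρ c κ₀) (hκ₀ : 0 < κ₀)
    (hρ0 : 0 < ρ) (hρ1 : ρ < 1) (h : TVVARCoefficients d K δ γ σ₁ σ₂ Φ Sig) (u : ℝ)
    {Z : ℤ → Matrix (Fin p) (Fin p) ℂ} {a : ℝ} (ha : 0 ≤ a)
    (hW : ∀ t, ‖Z t - ∑ j ∈ Finset.Icc 1 d, (Φ j u).map Complex.ofReal * Z (t - j)‖ ≤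
      a * ρ ^ t.natAbs) (hZ : ∃ M₀, ∀ t, ‖Z t‖ ≤ M₀) (t : ℤ) : ‖Z t‖ ≤ c * (a * ρ ^ t.natAbs) := by
  refine hS p Φ Sig h (fun _ => u) 0 le_rfl hκ₀.le (fun s t => by simp) Z
    (fun t => a * ρ ^ t.natAbs) (fun t => by positivity) (fun t m => ?_) hW hZ t
  have := mul_le_mul_of_nonneg_left (pow_mul_pow_natAbs_le hρ0.le hρ1.le t 0 m) ha
  simp only [sub_zero] at this
  linarith

/-- Geometric decay and Lipschitz dependence on `u` of a matrix sequence. -/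
structure GeomLipschitz {p : ℕ} (L ρ : ℝ) (G : ℤ → ℝ → Matrix (Fin p) (Fin p) ℂ) : Prop where
  decay : ∀ n u, ‖G n u‖ ≤ L * ρ ^ n.natAbs
  lipschitz : ∀ n u v, ‖G n u - G n v‖ ≤ L * |u - v| * ρ ^ n.natAbs

theorem GeomLipschitz.mono {p : ℕ} {L L' ρ : ℝ} (hρ0 : 0 < ρ)
    {G : ℤ → ℝ → Matrix (Fin p) (Fin p) ℂ} (h : GeomLipschitz L ρ G) (hL : L ≤ L') :
    GeomLipschitz L' ρ G where
  decay n u := (h.decay n u).trans (by gcongr)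
  lipschitz n u v := (h.lipschitz n u v).trans (by gcongr)

theorem bounded_of_decay {E : Type*} [NormedAddCommGroup E] {ρ L : ℝ} (hρ0 : 0 < ρ) (hρ1 : ρ < 1)
    (hL : 0 ≤ L) {G : ℤ → E} (h : ∀ n, ‖G n‖ ≤ L * ρ ^ n.natAbs) (n : ℤ) : ‖G n‖ ≤ L :=
  (h n).trans (mul_le_of_le_one_right hL (pow_le_one₀ hρ0.le hρ1.le))

/-- Sequences that solve the frozen autoregression with geometrically decaying and Lipschitz
residuals are themselves geometrically decaying and Lipschitz. -/
theorem IsStableRate.geomLipschitz {ρ c κ₀ : ℝ} (hS : IsStableRate d K δ γ σ₁ σ₂ ρ c κ₀)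
    (hc : 0 ≤ c) (hκ₀ : 0 < κ₀) (hρ0 : 0 < ρ) (hρ1 : ρ < 1)
    (h : TVVARCoefficients d K δ γ σ₁ σ₂ Φ Sig) {L : ℝ} (hL : 0 ≤ L)
    {G W : ℤ → ℝ → Matrix (Fin p) (Fin p) ℂ}
    (hG : ∀ n u, G n u - ∑ j ∈ Finset.Icc 1 d, (Φ j u).map Complex.ofReal * G (n - j) u = W n u)
    (hW : GeomLipschitz L ρ W) (hbdd : ∃ M₀, ∀ n u, ‖G n u‖ ≤ M₀) :
    GeomLipschitz (c * L + c * (L + d * (c * L) / ρ ^ d * |K|)) ρ G := by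
  have hdecay : ∀ n u, ‖G n u‖ ≤ c * L * ρ ^ n.natAbs := fun n u => by
    rw [mul_assoc]
    exact hS.frozen hκ₀ hρ0 hρ1 h u (Z := fun n => G n u) hL
      (fun t => by rw [hG]; exact hW.decay t u) (hbdd.imp fun M hM t => hM t u) n
  have hcL : 0 ≤ c * L := mul_nonneg hc hL
  have hx : 0 ≤ c * (L + d * (c * L) / ρ ^ d * |K|) := by positivity
  refine ⟨fun n u => (hdecay n u).trans ?_, fun n u v => ?_⟩
  · exact mul_le_mul_of_nonneg_right (by linarith) (by positivity)
  -- The increment `G n u - G n v` solves the recursion at `u`, with residual `W n u - W n v` plus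
  -- the coefficient differences applied to `G` at `v`.
  · have key := hS.frozen hκ₀ hρ0 hρ1 h u (Z := fun n => G n u - G n v)
      (a := (L + d * (c * L) / ρ ^ d * |K|) * |u - v|) (by positivity) (fun t => ?_) ?_ n
    · refine key.trans ?_
      have : 0 ≤ c * L * |u - v| * ρ ^ n.natAbs := by positivity
      linarith
    · have e : G t u - G t v - ∑ j ∈ Finset.Icc 1 d,
          (Φ j u).map Complex.ofReal * (G (t - j) u - G (t - j) v) = (W t u - W t v) +
          ∑ j ∈ Finset.Icc 1 d,
            ((Φ j u).map Complex.ofReal - (Φ j v).map Complex.ofReal) * G (t - j) v := by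
        rw [← hG t u, ← hG t v]
        simp only [mul_sub, sub_mul, Finset.sum_sub_distrib]
        abel
      rw [e]
      refine (norm_add_le _ _).trans ((add_le_add (hW.lipschitz t u v)
        (norm_sum_mul_le hρ0 hρ1.le (mul_nonneg (abs_nonneg K) (abs_nonneg (u - v))) hcL
          (fun j hj => h.norm_coeff_sub_le hj u v) (fun n => hdecay n v) t)).trans
        (le_of_eq ?_))
      ring
    · obtain ⟨M, hM⟩ := hbdd
      exact ⟨M + M, fun t => (norm_sub_le _ _).trans (add_le_add (hM t u) (hM t v))⟩

theorem IsStableRate.exists_geomLipschitz {ρ c κ₀ : ℝ} (hS : IsStableRate d K δ γ σ₁ σ₂ ρ c κ₀)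
    (hc : 0 ≤ c) (hκ₀ : 0 < κ₀) (hρ0 : 0 < ρ) (hρ1 : ρ < 1) (hδ : 0 < δ) (hγ : 0 < γ)
    (hσ : 0 < σ₁) : ∃ L : ℝ, 0 ≤ L ∧ ∀ (p : ℕ) (Φ : ℕ → ℝ → Matrix (Fin p) (Fin p) ℝ)
      (Sig : ℝ → Matrix (Fin p) (Fin p) ℝ), TVVARCoefficients d K δ γ σ₁ σ₂ Φ Sig →
      GeomLipschitz L ρ (fun n u => arGreen d Φ u n) ∧
      GeomLipschitz L ρ (fun n u => localAutocov d Φ Sig n u) := by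
  set L₁ := c * 1 + c * (1 + d * (c * 1) / ρ ^ d * |K|) with hL₁
  have hL₁0 : 0 ≤ L₁ := by positivity
  set L₂ := (|σ₂| + |K|) * L₁ with hL₂
  have hL₂0 : 0 ≤ L₂ := by positivity
  set L₃ := c * L₂ + c * (L₂ + d * (c * L₂) / ρ ^ d * |K|) with hL₃
  have hL₃0 : 0 ≤ L₃ := by positivity
  refine ⟨L₁ + L₃, by positivity, fun p Φ Sig h => ?_⟩
  -- Only an inequality, since the identity has norm `0` when `p = 0`.
  have hone : ‖(1 : Matrix (Fin p) (Fin p) ℂ)‖ ≤ 1 :=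
    Matrix.l2_opNorm_le_of_forall zero_le_one fun x => by simp
  have hq1 : (1 + δ)⁻¹ ≤ 1 := inv_le_one_of_one_le₀ (by linarith)
  have hB : GeomLipschitz L₁ ρ (fun n u => arGreen d Φ u n) := by
    refine hS.geomLipschitz hc hκ₀ hρ0 hρ1 h zero_le_one
      (W := fun n _ => if n = 0 then 1 else 0) (fun n u => (h.isGreenSeq hδ hγ u).right_inv n)
      ⟨fun n u => ?_, fun n u v => ?_⟩ ⟨γ⁻¹, fun n u => ?_⟩
    · split_ifs with hn
      · simpa [hn] using hone
      · simp only [norm_zero]; positivity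
    · simp only [sub_self, norm_zero]; positivity
    · exact ((h.isGreenSeq hδ hγ u).norm_le n).trans
        (mul_le_of_le_one_right (by positivity) (pow_le_one₀ (by positivity) hq1))
  have hσn : ∀ u, ‖(Sig u).map Complex.ofReal‖ ≤ |σ₂| := fun u =>
    (Matrix.norm_map_ofReal (Sig u)).trans_le (h.norm_sig_le hσ u)
  have hBt : ∀ n u, ‖(arGreen d Φ u (-n))ᵀ‖ ≤ L₁ * ρ ^ n.natAbs := fun n u => by
    rw [Matrix.norm_transpose_complex, ← Int.natAbs_neg]
    exact hB.decay (-n) u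
  have hC : GeomLipschitz L₃ ρ (fun n u => localAutocov d Φ Sig n u) := by
    refine hS.geomLipschitz hc hκ₀ hρ0 hρ1 h hL₂0
      (W := fun n u => (Sig u).map Complex.ofReal * (arGreen d Φ u (-n))ᵀ)
      (fun n u => h.localAutocov_autoregression hδ hγ n u)
      ⟨fun n u => ?_, fun n u v => ?_⟩ ⟨γ⁻¹ * |σ₂| * γ⁻¹, fun n u =>
        h.norm_localAutocov_le hδ hγ hσ n u⟩
    · refine (norm_mul_le _ _).trans ((mul_le_mul (hσn u) (hBt n u) (norm_nonneg _)
        (abs_nonneg _)).trans ?_)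
      have : 0 ≤ |K| * L₁ * ρ ^ n.natAbs := by positivity
      rw [hL₂]; linarith
    -- Product rule for the increment of `Σ(u) B(u)ᵀ`; it accounts for `L₂ = (|σ₂| + |K|) L₁`.
    · have e : (Sig u).map Complex.ofReal * (arGreen d Φ u (-n))ᵀ -
          (Sig v).map Complex.ofReal * (arGreen d Φ v (-n))ᵀ =
          (Sig u).map Complex.ofReal * (arGreen d Φ u (-n) - arGreen d Φ v (-n))ᵀ +
          ((Sig u).map Complex.ofReal - (Sig v).map Complex.ofReal) * (arGreen d Φ v (-n))ᵀ := by
        rw [Matrix.transpose_sub, mul_sub, sub_mul]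
        abel
      have h1 : ‖(arGreen d Φ u (-n) - arGreen d Φ v (-n))ᵀ‖ ≤ L₁ * |u - v| * ρ ^ n.natAbs := by
        rw [Matrix.norm_transpose_complex, ← Int.natAbs_neg]
        exact hB.lipschitz (-n) u v
      rw [e]
      refine (norm_add_le _ _).trans ((add_le_add
        ((norm_mul_le _ _).trans (mul_le_mul (hσn u) h1 (norm_nonneg _) (abs_nonneg _)))
        ((norm_mul_le _ _).trans (mul_le_mul (h.norm_sig_sub_le u v) (hBt n v) (norm_nonneg _)
          (by positivity)))).trans (le_of_eq ?_))
      rw [hL₂]; ring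
  exact ⟨hB.mono hρ0 (by linarith), hC.mono hρ0 (by linarith)⟩

end Constants

/-- The Yule–Walker type equations satisfied by the covariances `Γ t τ = cov[X_t, X_τ]` and
`D t s = cov[X_t, ε_s]` of a time-varying VAR(d) process with volatility matrices `S t`. -/
structure IsCovSystem {p : ℕ} (d : ℕ) (Φ : ℕ → ℝ → Matrix (Fin p) (Fin p) ℝ)
    (Sig : ℝ → Matrix (Fin p) (Fin p) ℝ) (N : ℕ) (S : ℤ → Matrix (Fin p) (Fin p) ℂ)
    (D Γ : ℤ → ℤ → Matrix (Fin p) (Fin p) ℂ) : Prop where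
  sq : ∀ t : ℤ, S t * (S t)ᵀ = (Sig ((t : ℝ) / N)).map Complex.ofReal
  innov : ∀ t s : ℤ, D t s - ∑ j ∈ Finset.Icc 1 d,
    (Φ j ((t : ℝ) / N)).map Complex.ofReal * D (t - j) s = if t = s then S t else 0
  yuleWalker : ∀ t τ : ℤ, Γ t τ - ∑ j ∈ Finset.Icc 1 d,
    (Φ j ((t : ℝ) / N)).map Complex.ofReal * Γ (t - j) τ = S t * (D τ t)ᵀ
  bounded_innov : ∀ s, ∃ M₀, ∀ t, ‖D t s‖ ≤ M₀
  bounded : ∀ τ, ∃ M₀, ∀ t, ‖Γ t τ‖ ≤ M₀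

/-! ### Time-varying covariances against the frozen model -/

section Comparison

variable {p d : ℕ} {K δ γ σ₁ σ₂ : ℝ} {Φ : ℕ → ℝ → Matrix (Fin p) (Fin p) ℝ}
  {Sig : ℝ → Matrix (Fin p) (Fin p) ℝ}

theorem natAbs_sub_swap (s t : ℤ) : (s - t).natAbs = (t - s).natAbs := by
  rw [← Int.natAbs_neg, neg_sub]

theorem abs_div_sub_div (N : ℕ) (s t : ℤ) :
    |(s : ℝ) / N - (t : ℝ) / N| = 1 / N * |(s : ℝ) - t| := by
  rw [← sub_div, abs_div, Nat.abs_cast]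
  ring

theorem abs_intCast_sub (s t : ℤ) : |(s : ℝ) - t| = ((s - t).natAbs : ℝ) := by
  rw [Nat.cast_natAbs]; push_cast; rfl

theorem IsStableRate.rescaled {ρ c κ₀ : ℝ} (hS : IsStableRate d K δ γ σ₁ σ₂ ρ c κ₀)
    (hρ0 : 0 < ρ) (hρ1 : ρ < 1) (h : TVVARCoefficients d K δ γ σ₁ σ₂ Φ Sig) {N : ℕ}
    (hN : 1 / (N : ℝ) ≤ κ₀) (s : ℤ) {Z : ℤ → Matrix (Fin p) (Fin p) ℂ} {a : ℝ} (ha : 0 ≤ a)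
    (hW : ∀ t : ℤ, ‖Z t - ∑ j ∈ Finset.Icc 1 d,
      (Φ j ((t : ℝ) / N)).map Complex.ofReal * Z (t - j)‖ ≤ a * ρ ^ (t - s).natAbs)
    (hZ : ∃ M₀, ∀ t, ‖Z t‖ ≤ M₀) (t : ℤ) : ‖Z t‖ ≤ c * (a * ρ ^ (t - s).natAbs) := by
  refine hS p Φ Sig h (fun t => (t : ℝ) / N) (1 / N) (by positivity) hN
    (fun s t => (abs_div_sub_div N s t).le) Z (fun t => a * ρ ^ (t - s).natAbs)
    (fun t => by positivity) (fun t m => ?_) hW hZ t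
  have := mul_le_mul_of_nonneg_left (pow_mul_pow_natAbs_le hρ0.le hρ1.le t s m) ha
  linarith

theorem IsCovSystem.norm_innov_le {ρ c κ₀ : ℝ} (hS : IsStableRate d K δ γ σ₁ σ₂ ρ c κ₀)
    (hρ0 : 0 < ρ) (hρ1 : ρ < 1) (h : TVVARCoefficients d K δ γ σ₁ σ₂ Φ Sig) {N : ℕ}
    (hN : 1 / (N : ℝ) ≤ κ₀) {S : ℤ → Matrix (Fin p) (Fin p) ℂ}
    {D Γ : ℤ → ℤ → Matrix (Fin p) (Fin p) ℂ} (hC : IsCovSystem d Φ Sig N S D Γ) {v : ℝ}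
    (hv : ∀ t, ‖S t‖ ≤ v) (t s : ℤ) : ‖D t s‖ ≤ c * (if s ≤ t then v * ρ ^ (t - s).natAbs else 0) := by
  have hv0 : 0 ≤ v := (norm_nonneg _).trans (hv 0)
  -- The weight vanishes before time `s`, so the bound includes causality: `D t s = 0` for `t < s`.
  refine hS p Φ Sig h (fun t => (t : ℝ) / N) (1 / N) (by positivity) hN
    (fun s t => (abs_div_sub_div N s t).le) (fun t => D t s)
    (fun t => if s ≤ t then v * ρ ^ (t - s).natAbs else 0)
    (fun t => by split_ifs <;> positivity) (fun t m => ?_) (fun t => ?_) (hC.bounded_innov s) t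
  · by_cases h1 : s ≤ t - m
    · rw [if_pos h1, if_pos (by omega)]
      have := mul_le_mul_of_nonneg_left (pow_mul_pow_natAbs_le hρ0.le hρ1.le t s m) hv0
      linarith
    · rw [if_neg h1, mul_zero]
      split_ifs <;> positivity
  · rw [hC.innov]
    by_cases hts : t = s
    · subst hts
      simpa using hv t
    · rw [if_neg hts, norm_zero]
      split_ifs <;> positivity

theorem IsCovSystem.norm_cov_le {ρ c κ₀ : ℝ} (hS : IsStableRate d K δ γ σ₁ σ₂ ρ c κ₀)
    (hc : 0 ≤ c) (hρ0 : 0 < ρ) (hρ1 : ρ < 1) (h : TVVARCoefficients d K δ γ σ₁ σ₂ Φ Sig) {N : ℕ}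
    (hN : 1 / (N : ℝ) ≤ κ₀) {S : ℤ → Matrix (Fin p) (Fin p) ℂ}
    {D Γ : ℤ → ℤ → Matrix (Fin p) (Fin p) ℂ} (hC : IsCovSystem d Φ Sig N S D Γ) {v : ℝ}
    (hv : ∀ t, ‖S t‖ ≤ v) (t τ : ℤ) : ‖Γ t τ‖ ≤ c * (v * (c * v) * ρ ^ (t - τ).natAbs) := by
  have hv0 : 0 ≤ v := (norm_nonneg _).trans (hv 0)
  refine hS.rescaled hρ0 hρ1 h hN τ (Z := fun t => Γ t τ) (by positivity) (fun t => ?_)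
    (hC.bounded τ) t
  rw [hC.yuleWalker]
  have h1 : ‖(D τ t)ᵀ‖ ≤ c * v * ρ ^ (t - τ).natAbs := by
    rw [Matrix.norm_transpose_complex, mul_assoc, natAbs_sub_swap]
    refine (hC.norm_innov_le hS hρ0 hρ1 h hN hv τ t).trans (mul_le_mul_of_nonneg_left ?_ hc)
    split_ifs
    · exact le_rfl
    · positivity
  refine (norm_mul_le _ _).trans ((mul_le_mul (hv t) h1 (norm_nonneg _) hv0).trans (le_of_eq ?_))
  ring

variable {ρ₁ ρ₂ c κ₀ L H v : ℝ}

/-- The covariances with the innovations are close to the coefficients of the frozen model. -/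
theorem IsCovSystem.norm_innov_sub_le (hS : IsStableRate d K δ γ σ₁ σ₂ ρ₂ c κ₀)
    (hρ₁ : 0 < ρ₁) (hρ₁1 : ρ₁ < 1) (hρ₂ : 0 < ρ₂) (hρ₂1 : ρ₂ < 1)
    (h : TVVARCoefficients d K δ γ σ₁ σ₂ Φ Sig) (hδ : 0 < δ) (hγ : 0 < γ) {N : ℕ}
    (hN : 1 / (N : ℝ) ≤ κ₀) (hL : 0 ≤ L) (hB : GeomLipschitz L ρ₁ (fun n u => arGreen d Φ u n))
    (hH : ∀ n : ℕ, n * ρ₁ ^ n ≤ H * ρ₂ ^ n) {S : ℤ → Matrix (Fin p) (Fin p) ℂ}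
    {D Γ : ℤ → ℤ → Matrix (Fin p) (Fin p) ℂ} (hC : IsCovSystem d Φ Sig N S D Γ)
    (hv : ∀ t, ‖S t‖ ≤ v) (t s : ℤ) :
    ‖D t s - arGreen d Φ ((s : ℝ) / N) (t - s) * S s‖ ≤
      c * (d * L / ρ₁ ^ d * |K| * H * v / N * ρ₂ ^ (t - s).natAbs) := by
  have hv0 : 0 ≤ v := (norm_nonneg _).trans (hv 0)
  have hH0 : 0 ≤ H := by simpa using hH 0
  refine hS.rescaled hρ₂ hρ₂1 h hN s
    (Z := fun t => D t s - arGreen d Φ ((s : ℝ) / N) (t - s) * S s) (by positivity) (fun t => ?_)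
    ?_ t
  -- The Green sequence frozen at `s / N` reproduces the impulse at `t = s`, which cancels. Only the
  -- drift of the coefficients from `s / N` to `t / N` remains.
  · have e : D t s - arGreen d Φ ((s : ℝ) / N) (t - s) * S s - ∑ j ∈ Finset.Icc 1 d,
        (Φ j ((t : ℝ) / N)).map Complex.ofReal *
          (D (t - j) s - arGreen d Φ ((s : ℝ) / N) (t - j - s) * S s) =
        (∑ j ∈ Finset.Icc 1 d, ((Φ j ((t : ℝ) / N)).map Complex.ofReal -
          (Φ j ((s : ℝ) / N)).map Complex.ofReal) * arGreen d Φ ((s : ℝ) / N) (t - s - j)) *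
          S s := by
      have h1 := hC.innov t s
      have h2 := congrArg (· * S s) ((h.isGreenSeq hδ hγ ((s : ℝ) / N)).right_inv (t - s))
      have h3 : (if t = s then S t else 0) = (if t - s = 0 then 1 else 0) * S s := by
        by_cases hts : t = s
        · simp [hts]
        · simp [hts, sub_eq_zero]
      rw [h3, ← h2] at h1
      simp only [sub_mul, mul_sub, Finset.sum_sub_distrib, Finset.sum_mul, mul_assoc,
        sub_right_comm t _ s] at h1 ⊢
      rw [sub_eq_iff_eq_add] at h1
      rw [h1]
      abel
    rw [e]
    have h1 := norm_sum_mul_le hρ₁ hρ₁1.le (d := d)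
      (mul_nonneg (abs_nonneg K) (abs_nonneg ((t : ℝ) / N - (s : ℝ) / N))) hL
      (fun j hj => h.norm_coeff_sub_le hj _ _) (fun n => hB.decay n ((s : ℝ) / N)) (t - s)
    rw [abs_div_sub_div, abs_intCast_sub] at h1
    have h2 := hH (t - s).natAbs
    calc _ ≤ d * L / ρ₁ ^ d * (|K| * (1 / N * ((t - s).natAbs : ℝ))) * ρ₁ ^ (t - s).natAbs * v :=
          (norm_mul_le _ _).trans (mul_le_mul h1 (hv s) (norm_nonneg _) (by positivity))
      _ = d * L / ρ₁ ^ d * |K| * v / N * ((t - s).natAbs * ρ₁ ^ (t - s).natAbs) := by ring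
      _ ≤ d * L / ρ₁ ^ d * |K| * v / N * (H * ρ₂ ^ (t - s).natAbs) :=
          mul_le_mul_of_nonneg_left h2 (by positivity)
      _ = _ := by ring
  · obtain ⟨M, hM⟩ := hC.bounded_innov s
    refine ⟨M + L * v, fun t => (norm_sub_le _ _).trans (add_le_add (hM t)
      ((norm_mul_le _ _).trans (mul_le_mul ?_ (hv s) (norm_nonneg _) hL)))⟩
    exact bounded_of_decay hρ₁ hρ₁1 hL (fun n => hB.decay n ((s : ℝ) / N)) (t - s)

theorem GeomLipschitz.norm_sub_le_div {G : ℤ → ℝ → Matrix (Fin p) (Fin p) ℂ}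
    (hG : GeomLipschitz L ρ₁ G) (hL : 0 ≤ L) (hH : ∀ n : ℕ, n * ρ₁ ^ n ≤ H * ρ₂ ^ n) (N : ℕ)
    (t s : ℤ) {n : ℤ} (hn : n.natAbs = (t - s).natAbs) :
    ‖G n ((t : ℝ) / N) - G n ((s : ℝ) / N)‖ ≤ L * H / N * ρ₂ ^ (t - s).natAbs := by
  refine (hG.lipschitz n _ _).trans ?_
  rw [hn, abs_div_sub_div, abs_intCast_sub]
  calc _ = L / N * ((t - s).natAbs * ρ₁ ^ (t - s).natAbs) := by ring
    _ ≤ L / N * (H * ρ₂ ^ (t - s).natAbs) :=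
      mul_le_mul_of_nonneg_left (hH _) (by positivity)
    _ = _ := by ring

/-- The covariances are close to the local autocovariances. -/
theorem IsCovSystem.norm_cov_sub_le (hS : IsStableRate d K δ γ σ₁ σ₂ ρ₂ c κ₀) (hc : 0 ≤ c)
    (hρ₁ : 0 < ρ₁) (hρ₁1 : ρ₁ < 1) (hρ₂ : 0 < ρ₂) (hρ₂1 : ρ₂ < 1)
    (h : TVVARCoefficients d K δ γ σ₁ σ₂ Φ Sig) (hδ : 0 < δ) (hγ : 0 < γ) (hσ : 0 < σ₁) {N : ℕ}
    (hN : 1 / (N : ℝ) ≤ κ₀) (hL : 0 ≤ L) (hB : GeomLipschitz L ρ₁ (fun n u => arGreen d Φ u n))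
    (hA : GeomLipschitz L ρ₁ (fun n u => localAutocov d Φ Sig n u))
    (hH : ∀ n : ℕ, n * ρ₁ ^ n ≤ H * ρ₂ ^ n) {S : ℤ → Matrix (Fin p) (Fin p) ℂ}
    {D Γ : ℤ → ℤ → Matrix (Fin p) (Fin p) ℂ} (hC : IsCovSystem d Φ Sig N S D Γ)
    (hv : ∀ t, ‖S t‖ ≤ v) (t τ : ℤ) :
    ‖Γ t τ - localAutocov d Φ Sig (t - τ) ((t : ℝ) / N)‖ ≤
      (c * (v * (c * (d * L / ρ₁ ^ d * |K| * H * v)) + |σ₂| * (L * H) + |K| * L * H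
        + d * L / ρ₁ ^ d * |K| * H) + L * H) * ρ₂ ^ (t - τ).natAbs / N := by
  have hv0 : 0 ≤ v := (norm_nonneg _).trans (hv 0)
  have hH0 : 0 ≤ H := by simpa using hH 0
  set a : ℝ := v * (c * (d * L / ρ₁ ^ d * |K| * H * v)) + |σ₂| * (L * H) + |K| * L * H
        + d * L / ρ₁ ^ d * |K| * H with ha
  have ha0 : 0 ≤ a := by positivity
  -- The recursion runs in `t` with `τ` fixed, so the comparison model is frozen at `τ / N`;
  -- Lipschitz continuity moves it to `t / N` afterwards.
  have hV : ∀ t, ‖Γ t τ - localAutocov d Φ Sig (t - τ) ((τ : ℝ) / N)‖ ≤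
      c * (a / N * ρ₂ ^ (t - τ).natAbs) := by
    refine hS.rescaled hρ₂ hρ₂1 h hN τ
      (Z := fun t => Γ t τ - localAutocov d Φ Sig (t - τ) ((τ : ℝ) / N)) (by positivity)
      (fun t => ?_) ?_
    · set U := D τ t - arGreen d Φ ((t : ℝ) / N) (τ - t) * S t with hU
      set E := ∑ j ∈ Finset.Icc 1 d, ((Φ j ((t : ℝ) / N)).map Complex.ofReal -
          (Φ j ((τ : ℝ) / N)).map Complex.ofReal) *
          localAutocov d Φ Sig (t - τ - j) ((τ : ℝ) / N) with hE
      -- The four residual terms are the error in the innovation covariance, then the changes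
      -- between `τ / N` and `t / N` of the Green coefficients, of `Sig` and of the `Φ j`.
      have e : Γ t τ - localAutocov d Φ Sig (t - τ) ((τ : ℝ) / N) - ∑ j ∈ Finset.Icc 1 d,
          (Φ j ((t : ℝ) / N)).map Complex.ofReal *
            (Γ (t - j) τ - localAutocov d Φ Sig (t - j - τ) ((τ : ℝ) / N)) =
          S t * Uᵀ + (Sig ((t : ℝ) / N)).map Complex.ofReal *
            (arGreen d Φ ((t : ℝ) / N) (τ - t) - arGreen d Φ ((τ : ℝ) / N) (τ - t))ᵀ +
          ((Sig ((t : ℝ) / N)).map Complex.ofReal - (Sig ((τ : ℝ) / N)).map Complex.ofReal) *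
            (arGreen d Φ ((τ : ℝ) / N) (τ - t))ᵀ + E := by
        have h1 := hC.yuleWalker t τ
        have h2 := h.localAutocov_autoregression hδ hγ (t - τ) ((τ : ℝ) / N)
        rw [neg_sub] at h2
        have h3 : S t * Uᵀ = S t * (D τ t)ᵀ - (Sig ((t : ℝ) / N)).map Complex.ofReal *
            (arGreen d Φ ((t : ℝ) / N) (τ - t))ᵀ := by
          rw [hU, Matrix.transpose_sub, Matrix.transpose_mul, mul_sub, ← mul_assoc, hC.sq]
        rw [h3, ← h1, Matrix.transpose_sub, mul_sub, sub_mul, ← h2, hE]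
        simp only [sub_mul, mul_sub, Finset.sum_sub_distrib, sub_right_comm t _ τ]
        abel
      rw [e]
      have b1 : ‖S t * Uᵀ‖ ≤
          v * (c * (d * L / ρ₁ ^ d * |K| * H * v / N * ρ₂ ^ (t - τ).natAbs)) := by
        refine (norm_mul_le _ _).trans (mul_le_mul (hv t) ?_ (norm_nonneg _) hv0)
        rw [Matrix.norm_transpose_complex, natAbs_sub_swap]
        exact hC.norm_innov_sub_le hS hρ₁ hρ₁1 hρ₂ hρ₂1 h hδ hγ hN hL hB hH hv τ t
      have b2 : ‖(Sig ((t : ℝ) / N)).map Complex.ofReal *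
            (arGreen d Φ ((t : ℝ) / N) (τ - t) - arGreen d Φ ((τ : ℝ) / N) (τ - t))ᵀ‖ ≤
          |σ₂| * (L * H / N * ρ₂ ^ (t - τ).natAbs) := by
        refine (norm_mul_le _ _).trans (mul_le_mul
          ((Matrix.norm_map_ofReal _).trans_le (h.norm_sig_le hσ _)) ?_ (norm_nonneg _)
          (abs_nonneg _))
        rw [Matrix.norm_transpose_complex]
        exact hB.norm_sub_le_div hL hH N t τ (natAbs_sub_swap _ _)
      have b3 : ‖((Sig ((t : ℝ) / N)).map Complex.ofReal -
          (Sig ((τ : ℝ) / N)).map Complex.ofReal) * (arGreen d Φ ((τ : ℝ) / N) (τ - t))ᵀ‖ ≤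
          |K| * L * H / N * ρ₂ ^ (t - τ).natAbs := by
        have hd := hB.decay (τ - t) ((τ : ℝ) / N)
        rw [← Matrix.norm_transpose_complex, natAbs_sub_swap] at hd
        have hs := h.norm_sig_sub_le ((t : ℝ) / N) ((τ : ℝ) / N)
        rw [abs_div_sub_div, abs_intCast_sub] at hs
        calc _ ≤ |K| * (1 / N * ((t - τ).natAbs : ℝ)) * (L * ρ₁ ^ (t - τ).natAbs) :=
              (norm_mul_le _ _).trans (mul_le_mul hs hd (norm_nonneg _) (by positivity))
          _ = |K| * L / N * ((t - τ).natAbs * ρ₁ ^ (t - τ).natAbs) := by ring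
          _ ≤ |K| * L / N * (H * ρ₂ ^ (t - τ).natAbs) :=
              mul_le_mul_of_nonneg_left (hH _) (by positivity)
          _ = _ := by ring
      have b4 : ‖E‖ ≤ d * L / ρ₁ ^ d * |K| * H / N * ρ₂ ^ (t - τ).natAbs := by
        have h1 := norm_sum_mul_le hρ₁ hρ₁1.le (d := d)
          (mul_nonneg (abs_nonneg K) (abs_nonneg ((t : ℝ) / N - (τ : ℝ) / N))) hL
          (fun j hj => h.norm_coeff_sub_le hj _ _) (fun n => hA.decay n ((τ : ℝ) / N)) (t - τ)
        rw [abs_div_sub_div, abs_intCast_sub] at h1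
        calc _ ≤ d * L / ρ₁ ^ d * (|K| * (1 / N * ((t - τ).natAbs : ℝ))) *
              ρ₁ ^ (t - τ).natAbs := h1
          _ = d * L / ρ₁ ^ d * |K| / N * ((t - τ).natAbs * ρ₁ ^ (t - τ).natAbs) := by ring
          _ ≤ d * L / ρ₁ ^ d * |K| / N * (H * ρ₂ ^ (t - τ).natAbs) :=
              mul_le_mul_of_nonneg_left (hH _) (by positivity)
          _ = _ := by ring
      refine (norm_add_le_of_le (norm_add_le_of_le (norm_add_le_of_le b1 b2) b3) b4).trans
        (le_of_eq ?_)
      rw [ha]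
      ring
    · obtain ⟨M, hM⟩ := hC.bounded τ
      exact ⟨M + L, fun t => (norm_sub_le _ _).trans (add_le_add (hM t)
        (bounded_of_decay hρ₁ hρ₁1 hL (fun n => hA.decay n ((τ : ℝ) / N)) (t - τ)))⟩
  have hLip := hA.norm_sub_le_div hL hH N t τ (n := t - τ) rfl
  calc ‖Γ t τ - localAutocov d Φ Sig (t - τ) ((t : ℝ) / N)‖
      ≤ ‖Γ t τ - localAutocov d Φ Sig (t - τ) ((τ : ℝ) / N)‖ +
        ‖localAutocov d Φ Sig (t - τ) ((t : ℝ) / N) -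
          localAutocov d Φ Sig (t - τ) ((τ : ℝ) / N)‖ := by
        rw [norm_sub_rev (localAutocov d Φ Sig (t - τ) ((t : ℝ) / N))]
        exact norm_sub_le_norm_sub_add_norm_sub _ _ _
    _ ≤ c * (a / N * ρ₂ ^ (t - τ).natAbs) + L * H / N * ρ₂ ^ (t - τ).natAbs :=
        add_le_add (hV t) hLip
    _ = _ := by ring

end Comparison

/-! ### Covariance matrices of the process and their recursions -/

section Covariance

variable {p : ℕ} {Ω : Type*} [MeasurableSpace Ω] {P : Measure Ω}

theorem covMatrix_transpose (X Y : Ω → Fin p → ℝ) : (covMatrix P X Y)ᵀ = covMatrix P Y X := by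
  ext a b
  exact covariance_comm _ _

theorem covMatrix_congr_left {X X' : Ω → Fin p → ℝ} (h : ∀ᵐ ω ∂P, X ω = X' ω)
    (Y : Ω → Fin p → ℝ) : covMatrix P X Y = covMatrix P X' Y := by
  ext a b
  have hm : (∫ ω, X ω a ∂P) = ∫ ω, X' ω a ∂P :=
    integral_congr_ae (h.mono fun ω hω => by simp only [hω])
  simp only [covMatrix, Matrix.of_apply, covariance, hm]
  exact integral_congr_ae (h.mono fun ω hω => by simp only [hω])

theorem memLp_mulVec {X : Ω → Fin p → ℝ} (hX : ∀ a, MemLp (fun ω => X ω a) 2 P)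
    (M : Matrix (Fin p) (Fin p) ℝ) (a : Fin p) : MemLp (fun ω => (M *ᵥ X ω) a) 2 P := by
  simp only [Matrix.mulVec, dotProduct]
  exact memLp_finsetSum _ fun k _ => (hX k).const_mul (M a k)

variable [IsProbabilityMeasure P]

theorem covMatrix_mulVec_left {X Y : Ω → Fin p → ℝ} (hX : ∀ a, MemLp (fun ω => X ω a) 2 P)
    (hY : ∀ a, MemLp (fun ω => Y ω a) 2 P) (M : Matrix (Fin p) (Fin p) ℝ) :
    covMatrix P (fun ω => M *ᵥ X ω) Y = M * covMatrix P X Y := by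
  ext a b
  simp only [covMatrix, Matrix.of_apply, Matrix.mulVec, dotProduct, Matrix.mul_apply]
  rw [covariance_fun_sum_left (fun k => (hX k).const_mul (M a k)) (hY b)]
  simp only [covariance_const_mul_left]

theorem covMatrix_add_left {X X' Y : Ω → Fin p → ℝ} (hX : ∀ a, MemLp (fun ω => X ω a) 2 P)
    (hX' : ∀ a, MemLp (fun ω => X' ω a) 2 P) (hY : ∀ a, MemLp (fun ω => Y ω a) 2 P) :
    covMatrix P (fun ω => X ω + X' ω) Y = covMatrix P X Y + covMatrix P X' Y := by
  ext a b
  exact covariance_add_left (hX a) (hX' a) (hY b)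

theorem covMatrix_sum_left {ι : Type*} (s : Finset ι) {X : ι → Ω → Fin p → ℝ} {Y : Ω → Fin p → ℝ}
    (hX : ∀ i a, MemLp (fun ω => X i ω a) 2 P) (hY : ∀ a, MemLp (fun ω => Y ω a) 2 P) :
    covMatrix P (fun ω => ∑ i ∈ s, X i ω) Y = ∑ i ∈ s, covMatrix P (X i) Y := by
  ext a b
  simp only [covMatrix, Matrix.of_apply, Finset.sum_apply, Matrix.sum_apply]
  exact covariance_fun_sum_left' (fun i _ => hX i a) (hY b)

/-- Both `Var[X + Y]` and `Var[X - Y]` are nonnegative. -/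
theorem abs_covariance_le_add_variance {X Y : Ω → ℝ} (hX : MemLp X 2 P) (hY : MemLp Y 2 P) :
    |cov[X, Y; P]| ≤ Var[X; P] + Var[Y; P] := by
  have h1 := variance_add hX hY
  have h2 := variance_sub hX hY
  have h3 := variance_nonneg (X + Y) P
  have h4 := variance_nonneg (X - Y) P
  have h5 := variance_nonneg X P
  have h6 := variance_nonneg Y P
  rw [abs_le]
  constructor <;> linarith

/-- This bound depends on `p`, which is harmless: it only supplies the qualitative boundedness that
the stability principle requires. -/
theorem norm_covMatrix_le {X Y : Ω → Fin p → ℝ} (hX : ∀ a, MemLp (fun ω => X ω a) 2 P)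
    (hY : ∀ a, MemLp (fun ω => Y ω a) 2 P) :
    ‖(covMatrix P X Y).map Complex.ofReal‖ ≤ ∑ i : Fin p, ∑ j : Fin p,
      (‖covMatrix P X X‖ + ‖covMatrix P Y Y‖) * ‖Matrix.single i j (1 : ℂ)‖ := by
  refine (Matrix.norm_le_sum_norm_entry _).trans (Finset.sum_le_sum fun i _ =>
    Finset.sum_le_sum fun j _ => mul_le_mul_of_nonneg_right ?_ (norm_nonneg _))
  have hvar : ∀ {Z : Ω → Fin p → ℝ}, (∀ a, MemLp (fun ω => Z ω a) 2 P) → ∀ a,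
      Var[fun ω => Z ω a; P] ≤ ‖covMatrix P Z Z‖ := fun {Z} hZ a => by
    rw [← covariance_self (hZ a).aestronglyMeasurable.aemeasurable]
    exact (le_abs_self _).trans ((covMatrix P Z Z).norm_entry_le a a)
  rw [Matrix.map_apply, Complex.norm_real]
  exact (abs_covariance_le_add_variance (hX i) (hY j)).trans (add_le_add (hvar hX i) (hvar hY j))

theorem map_ofReal_mul (A B : Matrix (Fin p) (Fin p) ℝ) :
    (A * B).map Complex.ofReal = A.map Complex.ofReal * B.map Complex.ofReal :=
  Matrix.map_mul (f := Complex.ofRealHom)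

theorem IsTVVAR.covMatrix_eq {d : ℕ} {Φ : ℕ → ℝ → Matrix (Fin p) (Fin p) ℝ}
    {Sig : ℝ → Matrix (Fin p) (Fin p) ℝ} {N : ℕ} {ε X : ℤ → Ω → Fin p → ℝ}
    (h : IsTVVAR d Φ Sig N P ε X) {Y : Ω → Fin p → ℝ} (hY : ∀ a, MemLp (fun ω => Y ω a) 2 P)
    (t : ℤ) : (covMatrix P (X t) Y).map Complex.ofReal - ∑ j ∈ Finset.Icc 1 d,
      (Φ j ((t : ℝ) / N)).map Complex.ofReal * (covMatrix P (X (t - j)) Y).map Complex.ofReal =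
      (CFC.sqrt (Sig ((t : ℝ) / N))).map Complex.ofReal *
        (covMatrix P (ε t) Y).map Complex.ofReal := by
  have h1 : covMatrix P (X t) Y = ∑ j ∈ Finset.Icc 1 d,
      Φ j ((t : ℝ) / N) * covMatrix P (X (t - j)) Y +
      CFC.sqrt (Sig ((t : ℝ) / N)) * covMatrix P (ε t) Y := by
    rw [covMatrix_congr_left (h.equation t), covMatrix_add_left (fun a => ?_)
      (memLp_mulVec (h.memLp_innov t) _) hY, covMatrix_sum_left _
      (X := fun j ω => Φ j ((t : ℝ) / N) *ᵥ X (t - j) ω)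
      (fun j => memLp_mulVec (h.memLp (t - j)) _) hY, covMatrix_mulVec_left (h.memLp_innov t) hY]
    · simp only [covMatrix_mulVec_left (h.memLp _) hY]
    · simp only [Finset.sum_apply]
      exact memLp_finsetSum _ fun j _ => memLp_mulVec (h.memLp (t - j)) _ a
  rw [sub_eq_iff_eq_add', h1]
  simp only [← map_ofReal_mul]
  ext a b
  simp [Matrix.sum_apply]

theorem IsTVVAR.isCovSystem {d : ℕ} {K δ γ σ₁ σ₂ : ℝ} {Φ : ℕ → ℝ → Matrix (Fin p) (Fin p) ℝ}
    {Sig : ℝ → Matrix (Fin p) (Fin p) ℝ} (hT : TVVARCoefficients d K δ γ σ₁ σ₂ Φ Sig) {N : ℕ}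
    {ε X : ℤ → Ω → Fin p → ℝ} (h : IsTVVAR d Φ Sig N P ε X) :
    IsCovSystem d Φ Sig N (fun t => (CFC.sqrt (Sig ((t : ℝ) / N))).map Complex.ofReal)
      (fun t s => (covMatrix P (X t) (ε s)).map Complex.ofReal)
      (fun t τ => (covMatrix P (X t) (X τ)).map Complex.ofReal) where
  sq t := by
    rw [← Matrix.transpose_map, ← map_ofReal_mul, hT.sqrt_sig_mul_sqrt_sig]
  innov t s := by
    rw [h.covMatrix_eq (h.memLp_innov s)]
    split_ifs with hts
    · rw [hts, h.var_innov, ← map_ofReal_mul, mul_one]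
    · rw [h.uncorrelated_innov t s hts, ← map_ofReal_mul, mul_zero]
      ext a b
      simp
  yuleWalker t τ := by
    rw [h.covMatrix_eq (h.memLp τ), ← Matrix.transpose_map, covMatrix_transpose]
  bounded_innov s := by
    obtain ⟨B, hB⟩ := h.bounded
    refine ⟨_, fun t => (norm_covMatrix_le (h.memLp t) (h.memLp_innov s)).trans
      (Finset.sum_le_sum fun i _ => Finset.sum_le_sum fun j _ =>
        mul_le_mul_of_nonneg_right (add_le_add_left (hB t) _) (norm_nonneg _))⟩
  bounded τ := by
    obtain ⟨B, hB⟩ := h.bounded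
    refine ⟨_, fun t => (norm_covMatrix_le (h.memLp t) (h.memLp τ)).trans
      (Finset.sum_le_sum fun i _ => Finset.sum_le_sum fun j _ =>
        mul_le_mul_of_nonneg_right (add_le_add_left (hB t) _) (norm_nonneg _))⟩

end Covariance

/-! ### Choice of the rates and constants -/

theorem exists_natCast_mul_pow_le {ρ₁ ρ₂ : ℝ} (h1 : 0 < ρ₁) (h12 : ρ₁ < ρ₂) :
    ∃ H : ℝ, ∀ n : ℕ, n * ρ₁ ^ n ≤ H * ρ₂ ^ n := by
  have h2 : 0 < ρ₂ := h1.trans h12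
  obtain ⟨H, hH⟩ := (tendsto_self_mul_const_pow_of_lt_one (r := ρ₁ / ρ₂) (by positivity)
    ((div_lt_one h2).mpr h12)).bddAbove_range
  refine ⟨H, fun n => ?_⟩
  have := hH ⟨n, rfl⟩
  simp only [div_pow] at this
  rwa [← mul_div_assoc, div_le_iff₀ (by positivity)] at this

theorem mainTheorem10 (d : ℕ) (K δ γ σ₁ σ₂ : ℝ) (hδ : 0 < δ) (hγ : 0 < γ) (hσ : 0 < σ₁) :
    ∃ (N₀ : ℕ) (ρ 𝒦 : ℝ), 0 < ρ ∧ ρ < 1 ∧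
      ∀ (p : ℕ) (Φ : ℕ → ℝ → Matrix (Fin p) (Fin p) ℝ) (Sig : ℝ → Matrix (Fin p) (Fin p) ℝ),
        TVVARCoefficients d K δ γ σ₁ σ₂ Φ Sig →
        (∀ (r : ℤ) (u v : ℝ),
          ‖localAutocov d Φ Sig r u - localAutocov d Φ Sig r v‖ ≤ 𝒦 * |u - v| * ρ ^ r.natAbs) ∧
        ∀ N : ℕ, N₀ < N →
          ∀ (Ω : Type*) [MeasurableSpace Ω] (P : Measure Ω) [IsProbabilityMeasure P]
            (ε X : ℤ → Ω → Fin p → ℝ),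
            IsTVVAR d Φ Sig N P ε X →
            ∀ t τ : ℤ,
              ‖covMatrix P (X t) (X τ)‖ ≤ 𝒦 * ρ ^ (t - τ).natAbs ∧
              ‖(covMatrix P (X t) (X τ)).map Complex.ofReal
                  - localAutocov d Φ Sig (t - τ) ((t : ℝ) / N)‖
                ≤ 𝒦 * ρ ^ (t - τ).natAbs / N := by
  have hq0 : 0 < (1 + δ)⁻¹ := by positivity
  have hq1 : (1 + δ)⁻¹ < 1 := inv_lt_one_of_one_lt₀ (by linarith)
  -- Two rates above `(1 + δ)⁻¹`: decay and Lipschitz bounds hold at `ρ₁`, and the gap to `ρ₂`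
  -- absorbs the factor `|t - τ|` in the comparison.
  obtain ⟨ρ₁, hqρ₁, hρ₁1⟩ := exists_between hq1
  obtain ⟨ρ₂, hρ₁₂, hρ₂1⟩ := exists_between hρ₁1
  have hρ₁ : 0 < ρ₁ := hq0.trans hqρ₁
  have hρ₂ : 0 < ρ₂ := hρ₁.trans hρ₁₂
  obtain ⟨c₁, κ₁, hc₁, hκ₁, hS₁⟩ := exists_isStableRate d K σ₁ σ₂ hδ hγ hqρ₁ hρ₁1
  obtain ⟨c₂, κ₂, hc₂, hκ₂, hS₂⟩ :=
    exists_isStableRate d K σ₁ σ₂ hδ hγ (hqρ₁.trans hρ₁₂) hρ₂1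
  obtain ⟨L, hL, hGL⟩ := hS₁.exists_geomLipschitz hc₁ hκ₁ hρ₁ hρ₁1 hδ hγ hσ
  obtain ⟨H, hH⟩ := exists_natCast_mul_pow_le hρ₁ hρ₁₂
  -- For `N > N₀` the path `t / N` moves by at most `min κ₁ κ₂` per step, so it is slow enough for
  -- both rates.
  obtain ⟨N₀, hN₀⟩ := exists_nat_ge (1 / min κ₁ κ₂)
  set v := √|σ₂| with hv
  have hv0 : 0 ≤ v := Real.sqrt_nonneg _
  set k₁ := c₁ * (v * (c₁ * v)) with hk₁
  set k₂ := c₂ * (v * (c₂ * (d * L / ρ₁ ^ d * |K| * H * v)) + |σ₂| * (L * H) + |K| * L * H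
        + d * L / ρ₁ ^ d * |K| * H) + L * H with hk₂
  have hk₁0 : 0 ≤ k₁ := by positivity
  have hpow : ∀ n : ℕ, ρ₁ ^ n ≤ ρ₂ ^ n := fun n => pow_le_pow_left₀ hρ₁.le hρ₁₂.le n
  refine ⟨N₀, ρ₂, L + k₁ + |k₂|, hρ₂, hρ₂1, fun p Φ Sig h => ⟨fun r u w => ?_, ?_⟩⟩
  · refine ((hGL p Φ Sig h).2.lipschitz r u w).trans ?_
    have := abs_nonneg k₂
    exact mul_le_mul (mul_le_mul_of_nonneg_right (by linarith) (abs_nonneg _)) (hpow _)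
      (by positivity) (by positivity)
  · intro N hN Ω _ P _ ε X hX t τ
    have hNκ : 1 / (N : ℝ) ≤ min κ₁ κ₂ := by
      have hm : 0 < min κ₁ κ₂ := lt_min hκ₁ hκ₂
      have hN' : (N₀ : ℝ) < N := by exact_mod_cast hN
      have hpos : (0 : ℝ) < N := (Nat.cast_nonneg N₀).trans_lt hN'
      rw [one_div_le hpos hm]
      exact hN₀.trans hN'.le
    have hC := hX.isCovSystem h
    have hvol : ∀ t : ℤ, ‖(CFC.sqrt (Sig ((t : ℝ) / N))).map Complex.ofReal‖ ≤ v := fun t =>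
      (Matrix.norm_map_ofReal _).trans_le (h.norm_sqrt_sig_le hσ _)
    constructor
    · have h1 := hC.norm_cov_le hS₁ hc₁ hρ₁ hρ₁1 h (hNκ.trans (min_le_left _ _)) hvol t τ
      rw [Matrix.norm_map_ofReal] at h1
      refine h1.trans ?_
      have := abs_nonneg k₂
      rw [← mul_assoc, ← hk₁]
      exact mul_le_mul (by linarith) (hpow _) (by positivity) (by positivity)
    · have h2 := hC.norm_cov_sub_le hS₂ hc₂ hρ₁ hρ₁1 hρ₂ hρ₂1 h hδ hγ hσ
        (hNκ.trans (min_le_right _ _)) hL (hGL p Φ Sig h).1 (hGL p Φ Sig h).2 hH hvol t τ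
      refine h2.trans ?_
      have := le_abs_self k₂
      exact div_le_div_of_nonneg_right (mul_le_mul_of_nonneg_right
        (show k₂ ≤ L + k₁ + |k₂| by linarith) (by positivity)) (Nat.cast_nonneg N)
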